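/- **Setting.** Let $Y = X\beta + \epsilon$ with a fixed $n\times p$ design $X$, $\beta\in\mathbb{R}^p$, $S=\{j:\beta_j\neq 0\}$, $s=|S|$, and independent errors $\epsilon_1,\dots,\epsilon_n$ with mean $0$, variance $\sigma^2$ and $E|\epsilon_l|^{2k}\le M$ for some real $k>0$. The $n$ observations are partitioned into $m\ge 1$ subsets $(Y^{(i)},X^{(i)})$ of equal size $r=n/m$. Fix constants $V_1,V_2,c_0,c_1,c_2,\eta>0$ and $0\le\iota<\tau\le 1$ with $c_0<2c_2V_2/\sqrt{c_1}$, and suppose that every subset satisfies: * (A.1) $\frac1r\|x_j^{(i)}\|_2^2\le V_1$ for every column $x^{(i)}_j$ of $X^{(i)}$, and $\lambda_{\min}\big(\frac1r X_S^{(i)T}X^{(i)}_S\big)\ge V_2$; * (A.2) $s\le c_1r^{\iota}$ and $\min_{j\in S}|\beta_j|\ge c_2r^{-(1-\tau)/2}$; * (A.3) $\big|X_{S^c}^{(i)T}X_S^{(i)}(X_S^{(i)T}X_S^{(i)})^{-1}\mathrm{sign}(\beta_S)\big|<1-\eta$ entrywise. For each $i$ let $\hat\beta^{(i)}$ be any minimizer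 of $\frac1r\|Y^{(i)}-X^{(i)}b\|_2^2+\lambda\|b\|_1$ with $$\lambda=c_0\,(n/m)^{-\frac{\iota-\tau+1}{2}},$$ and let $\gamma^{(i)}\in\{0,1\}^p$ indicate its non-zero coordinates. Let $\gamma$ be any (measurable) minimizer of $\sum_{i=1}^m\|\gamma-\gamma^{(i)}\|_1$ over $\{0,1\}^p$ (a coordinatewise median, i.e. majority vote with ties broken arbitrarily), and $M_\gamma\subseteq\{1,\dots,p\}$ the corresponding model. Let $\bar\beta$ be the average over $i$ of the least squares estimators $(X_\gamma^{(i)T}X_\gamma^{(i)})^{-1}X_\gamma^{(i)T}Y^{(i)}$, extended by $0$ outside $M_\gamma$. **Theorem.** There is a constant $C_0>0$, depending only on $k,\tau,\iota,V_1,V_2,c_0,c_1,c_2,\eta,\sigma,M$, such that the following holds whenever $p\le n^\alpha$ for some $\alpha<k(\tau-\iota)$, $\delta\in(0,1/2)$, $n\ge(2C_0p)^{1/(k\tau-k\iota)}$ and $$m=\Big\lfloor (\delta/C_0)^{1/(k\tau-k\iota)}\,n/p^{1/(k\tau-k\iota)}\Big\rfloor\ge 1 .$$ With $$\rho=\exp\Big\{-\frac{(1/2-\delta)^2}{2(1-\delta)}\Big(\frac{\delta}{C_0}\Big)^{1/(k\tau-k\iota)}n^{1-\alpha/(k\tau-k\iota)}\Big\}$$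 one has $P(M_\gamma=S)\ge 1-\rho$. Moreover, for every constant $C_0'>0$ with $\min_i\lambda_{\min}(X_\gamma^{(i)T}X_\gamma^{(i)}/r)\ge C_0'$ almost surely, $\|\bar\beta-\beta\|_2^2$ is integrable and $$E\|\bar\beta-\beta\|_2^2\le\frac{\sigma^2V_2^{-1}s}{n}+\rho\Big((1+2C_0'^{-1}sV_1)\|\beta\|_2^2+C_0'^{-1}\sigma^2\Big).$$ (For $\delta=1/4$ the constant $\frac{(1/2-\delta)^2}{2(1-\delta)}$ equals $1/24$.) -/

import Mathlib

open MeasureTheory ProbabilityTheory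

noncomputable section

namespace Message

variable {r p m : ℕ}

/-- The model of a coefficient vector: the set of features whose coefficient is non-zero. -/
def supp (b : Fin p → ℝ) : Finset (Fin p) := Finset.univ.filter (fun j => b j ≠ 0)

/-- Squared Euclidean norm. -/
def sqNorm {κ : Type*} [Fintype κ] (v : κ → ℝ) : ℝ := ∑ j, (v j) ^ 2

/-- `X_G`: the columns of `X` with index in `G`. -/
def cols (X : Matrix (Fin r) (Fin p) ℝ) (G : Finset (Fin p)) : Matrix (Fin r) G ℝ :=
  X.submatrix id Subtype.val

/-- `X_Gᵀ X_G`. -/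
def gram (X : Matrix (Fin r) (Fin p) ℝ) (G : Finset (Fin p)) : Matrix G G ℝ :=
  (cols X G).transpose * cols X G

/-- `λ_min (A) ≥ c`: every eigenvalue of `A` is at least `c` (used for real symmetric `A`;
no condition if `A` is the empty matrix). -/
def MinEigenvalueGE {κ : Type*} [Fintype κ] [DecidableEq κ] (A : Matrix κ κ ℝ) (c : ℝ) : Prop :=
  ∀ t ∈ spectrum ℝ A, c ≤ t

/-- Consistency condition for estimation, on a subset with `r` observations and design `X`. -/
structure CondA1 (V₁ V₂ : ℝ) (X : Matrix (Fin r) (Fin p) ℝ) (β : Fin p → ℝ) : Prop where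
  col_le : ∀ j, (1 / (r : ℝ)) * ∑ l, (X l j) ^ 2 ≤ V₁
  eig_ge : MinEigenvalueGE ((1 / (r : ℝ)) • gram X (supp β)) V₂

/-- Sparsity and minimal signal strength, on a subset with `r` observations. -/
structure CondA2 (c₁ c₂ ι τ : ℝ) (r : ℕ) (β : Fin p → ℝ) : Prop where
  sparse : ((supp β).card : ℝ) ≤ c₁ * (r : ℝ) ^ ι
  signal : ∀ j ∈ supp β, c₂ * (r : ℝ) ^ (-((1 - τ) / 2)) ≤ |β j|

/-- The strong irrepresentable condition
`|X_{Sᶜ}ᵀ X_S (X_Sᵀ X_S)⁻¹ sign(β_S)| < 1 - η`, entrywise. -/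
def CondA3 (η : ℝ) (X : Matrix (Fin r) (Fin p) ℝ) (β : Fin p → ℝ) : Prop :=
  ∀ j : ((supp β)ᶜ : Finset (Fin p)),
    |((cols X (supp β)ᶜ).transpose * cols X (supp β) * (gram X (supp β))⁻¹).mulVec
        (fun a => Real.sign (β a)) j| < 1 - η

/-- Independent centred errors with variance `σ²` and `2k`-th absolute moment at most `M`. -/
structure ErrorModel {Ω : Type*} [MeasurableSpace Ω] (μ : Measure Ω) {n : ℕ}
    (k σ M : ℝ) (ε : Fin n → Ω → ℝ) : Prop where
  meas : ∀ l, Measurable (ε l)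
  indep : iIndepFun ε μ
  sq_integrable : ∀ l, MemLp (ε l) 2 μ
  mean : ∀ l, ∫ ω, ε l ω ∂μ = 0
  var : ∀ l, variance (ε l) μ = σ ^ 2
  moment_integrable : ∀ l, Integrable (fun ω => |ε l ω| ^ (2 * k)) μ
  moment_le : ∀ l, ∫ ω, |ε l ω| ^ (2 * k) ∂μ ≤ M

/-- `(1/r) ‖Y - X b‖₂² + lam ‖b‖₁`. -/
def lassoLoss (lam : ℝ) (X : Matrix (Fin r) (Fin p) ℝ) (Y : Fin r → ℝ) (b : Fin p → ℝ) : ℝ :=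
  (1 / (r : ℝ)) * sqNorm (Y - X.mulVec b) + lam * ∑ j, |b j|

/-- `b` is a Lasso estimate (a minimizer of the Lasso loss). -/
def IsLasso (lam : ℝ) (X : Matrix (Fin r) (Fin p) ℝ) (Y : Fin r → ℝ) (b : Fin p → ℝ) : Prop :=
  ∀ b', lassoLoss lam X Y b ≤ lassoLoss lam X Y b'

/-- `G` is a median model of the models `γ 1, …, γ m`: it minimizes `∑ᵢ ‖G - γ i‖₁` over all
models. For 0/1 inclusion vectors the `ℓ¹` distance is the size of the symmetric difference. -/
def IsMedianModel (γ : Fin m → Finset (Fin p)) (G : Finset (Fin p)) : Prop :=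
  ∀ H : Finset (Fin p), ∑ i, (symmDiff G (γ i)).card ≤ ∑ i, (symmDiff H (γ i)).card

/-- Ordinary least squares in the model `G`, `(X_Gᵀ X_G)⁻¹ X_Gᵀ Y`, extended by zero outside `G`. -/
def ols (X : Matrix (Fin r) (Fin p) ℝ) (Y : Fin r → ℝ) (G : Finset (Fin p)) : Fin p → ℝ :=
  fun j => if h : j ∈ G then
    ((gram X G)⁻¹.mulVec ((cols X G).transpose.mulVec Y)) ⟨j, h⟩ else 0

/-- Design matrix of subset `i` under the partition `e` of the `n` observations into `m` subsets
of `r` observations each. -/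
def subX {n : ℕ} (e : Fin n ≃ Fin m × Fin r) (X : Matrix (Fin n) (Fin p) ℝ) (i : Fin m) :
    Matrix (Fin r) (Fin p) ℝ :=
  X.submatrix (fun l => e.symm (i, l)) id

/-- Response vector of subset `i`. -/
def subY {n : ℕ} (e : Fin n ≃ Fin m × Fin r) (Y : Fin n → ℝ) (i : Fin m) : Fin r → ℝ :=
  fun l => Y (e.symm (i, l))

/-- The aggregated estimator: the average over the subsets of the least squares estimates in the
model `G`. -/
def aggregated {n : ℕ} (e : Fin n ≃ Fin m × Fin r) (X : Matrix (Fin n) (Fin p) ℝ)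
    (Y : Fin n → ℝ) (G : Finset (Fin p)) : Fin p → ℝ :=
  fun j => (∑ i, ols (subX e X i) (subY e Y i) G j) / (m : ℝ)

/-- `exp(-(1/2-δ)²/(2(1-δ)) (δ/C₀)^{1/(kτ-kι)} n^{1-α/(kτ-kι)})`. -/
def failBound (C₀ δ k τ ι α : ℝ) (n : ℕ) : ℝ :=
  Real.exp (-((1 / 2 - δ) ^ 2 / (2 * (1 - δ)) * (δ / C₀) ^ (k * τ - k * ι)⁻¹ *
    (n : ℝ) ^ (1 - α * (k * τ - k * ι)⁻¹)))

end Message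

end

open scoped ENNReal

namespace Message

/-! ### Tail bounds for weighted sums of independent errors -/

/-! Write `κ = k(τ - ι)`.

One block. By the primal-dual witness argument (`IsLasso.supp_eq`), the Lasso on a block has the
right support as soon as the noise is small in `p` fixed directions: the least squares weights for
coordinates in `S`, and the columns projected off `X_S` for the others. In each direction the ratio
of squared norm to squared threshold is at most `D r^{-(τ-ι)}`. A tail bound of order `k` in this
ratio (`exists_tail_bound`) and a union bound over `p` give failure probability at most `K D^k p
r^{-κ}`. The choice of `m` amounts to `p ≤ (δ/C₀) r^κ`, so a large `C₀` pushes this below any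
prescribed constant, in particular below `1/64`.

Majority. The median model can differ from `S` only if at least half of the blocks fail
(`IsMedianModel.eq_of_majority`). Blocks are independent, and there are at most `2^m` sets of
failing blocks, each of probability at most `(1/64)^{m/2}`. Hence this event `B` has probability at
most `(1/4)^m`. The exponent in `ρ` is at most `m/2`, so `(1/2)^m ≤ ρ`, which leaves a spare factor
two.

Risk. Off `B` the estimator is the average of the oracle least squares fits, whose loss is quadratic
in the noise with mean at most `σ² s / (V₂ n)`. On `B` the loss is bounded by a multiple of `‖β‖²`
plus an average of the normalized noise energies in the column spaces of the blocks. Energy and `B`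
are dependent, so the counting argument is run with the energy of one block as an extra factor
(`setLIntegral_majority_le`). It requires that this energy restricted to the failure event of its
own block has integral at most `σ²/64`. For `k > 1` this is uniform integrability; for `k ≤ 1` it
holds because `p ≤ r/64` and the column space has dimension at most `p`. -/

lemma rpow_mul_self_sub_le {e a b : ℝ} (he : 0 ≤ e) (hb : 0 ≤ b) (hab : b ≤ a) :
    a ^ e * a - b ^ e * b ≤ (e + 1) * a ^ e * (a - b) := by
  rcases hb.eq_or_lt with rfl | hb
  · have : 0 ≤ a ^ e := Real.rpow_nonneg hab _
    nlinarith [mul_nonneg he (mul_nonneg this hab)]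
  have ha : 0 < a := hb.trans_le hab
  -- Bernoulli at `b / a`: the graph of `t ^ (e + 1)` lies above its tangent at `a`.
  have h := one_add_mul_self_le_rpow_one_add (s := b / a - 1) (p := e + 1)
    (by have : 0 < b / a := div_pos hb ha
        linarith) (by linarith)
  rw [show 1 + (b / a - 1) = b / a by ring, Real.div_rpow hb.le ha.le,
    Real.rpow_add_one hb.ne', Real.rpow_add_one ha.ne', le_div_iff₀ (by positivity)] at h
  have h2 : (1 + (e + 1) * (b / a - 1)) * (a ^ e * a) =
      a ^ e * a + (e + 1) * a ^ e * (b - a) := by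
    field_simp
  rw [h2] at h
  linarith

lemma abs_rpow_mul_self_sub_le {e a b R : ℝ} (he : 0 ≤ e) (ha : |a| ≤ R) (hb : |b| ≤ R) :
    |(|a| ^ e * a - |b| ^ e * b)| ≤ (e + 1) * R ^ e * |a - b| := by
  have hmono : ∀ x : ℝ, |x| ≤ R → |x| ^ e ≤ R ^ e := fun x hx =>
    Real.rpow_le_rpow (abs_nonneg _) hx he
  have hpos : ∀ x : ℝ, 0 ≤ |x| ^ e := fun x => Real.rpow_nonneg (abs_nonneg _) _
  have key : ∀ a b : ℝ, 0 ≤ b → b ≤ a → |a| ≤ R →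
      |(|a| ^ e * a - |b| ^ e * b)| ≤ (e + 1) * R ^ e * |a - b| := by
    intro a b hb hab haR
    have h := rpow_mul_self_sub_le he hb hab
    have ha : 0 ≤ a := hb.trans hab
    have h1 := hmono a haR
    rw [abs_of_nonneg ha] at h1
    rw [abs_of_nonneg ha, abs_of_nonneg hb, abs_of_nonneg (sub_nonneg.2 hab), abs_of_nonneg]
    · refine h.trans ?_
      have := sub_nonneg.2 hab
      gcongr
    · rw [sub_nonneg]
      gcongr
  have key2 : ∀ a b : ℝ, b ≤ 0 → 0 ≤ a → |a| ≤ R → |b| ≤ R →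
      |(|a| ^ e * a - |b| ^ e * b)| ≤ (e + 1) * R ^ e * |a - b| := by
    intro a b hb ha haR hbR
    have h1 := hmono a haR
    have h2 := hmono b hbR
    have h3 := hpos a
    have h4 := hpos b
    rw [abs_of_nonneg (by linarith : 0 ≤ a - b), abs_of_nonneg (by nlinarith)]
    have h5 : 0 ≤ R ^ e := h3.trans h1
    nlinarith [mul_nonneg he (mul_nonneg h5 (by linarith : 0 ≤ a - b)),
      mul_nonneg (sub_nonneg.2 h1) ha, mul_nonneg (sub_nonneg.2 h2) (neg_nonneg.2 hb)]
  rcases le_total 0 a with h0a | h0a <;> rcases le_total 0 b with h0b | h0b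
  · rcases le_total b a with h | h
    · exact key a b h0b h ha
    · rw [abs_sub_comm, abs_sub_comm a]; exact key b a h0a h hb
  · exact key2 a b h0b h0a ha hb
  · rw [abs_sub_comm, abs_sub_comm a]; exact key2 b a h0a h0b hb ha
  · have hneg : |(|a| ^ e * a - |b| ^ e * b)| = |(|-b| ^ e * -b - |-a| ^ e * -a)| := by
      rw [abs_neg, abs_neg]; congr 1; ring
    have hneg' : |a - b| = |-b - -a| := by congr 1; ring
    have hneg2 : |(|a| ^ e * a - |b| ^ e * b)| = |(|-a| ^ e * -a - |-b| ^ e * -b)| := by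
      rw [abs_neg, abs_neg, ← abs_neg]; congr 1; ring
    have hneg2' : |a - b| = |-a - -b| := by rw [← abs_neg]; congr 1; ring
    rcases le_total b a with h | h
    · rw [hneg, hneg']; exact key (-b) (-a) (by linarith) (by linarith) (by rwa [abs_neg])
    · rw [hneg2, hneg2']; exact key (-a) (-b) (by linarith) (by linarith) (by rwa [abs_neg])

/-- Second-order Taylor bound: after subtracting the linear term, the derivative is controlled by
the Lipschitz bound for `|t| ^ (q - 2) * t`. The linear term is kept exact because it integrates to
zero when `y` is centred and independent of `x`. -/
lemma abs_add_rpow_le {q : ℝ} (hq : 2 < q) (x y : ℝ) :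
    |x + y| ^ q ≤ |x| ^ q + q * (|x| ^ (q - 2) * x) * y +
      q * (q - 1) * 2 ^ (q - 2) * (|x| ^ (q - 2) * y ^ 2 + |y| ^ q) := by
  set g : ℝ → ℝ := fun t => |t| ^ q - q * (|x| ^ (q - 2) * x) * t with hg
  have hder : ∀ t ∈ segment ℝ x (x + y),
      HasDerivWithinAt g (q * |t| ^ (q - 2) * t - q * (|x| ^ (q - 2) * x))
        (segment ℝ x (x + y)) t := by
    intro t _
    have h1 := hasDerivAt_abs_rpow t (p := q) (by linarith)
    have h2 := (hasDerivAt_id t).const_mul (q * (|x| ^ (q - 2) * x))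
    have h3 := (h1.sub h2).hasDerivWithinAt (s := segment ℝ x (x + y))
    rw [mul_one] at h3
    exact h3
  have hbound : ∀ t ∈ segment ℝ x (x + y),
      ‖q * |t| ^ (q - 2) * t - q * (|x| ^ (q - 2) * x)‖ ≤
        q * (q - 1) * (|x| + |y|) ^ (q - 2) * |y| := by
    intro t ht
    have htx : |t - x| ≤ |y| := by
      have := norm_sub_le_of_mem_segment ht
      simpa using this
    have htR : |t| ≤ |x| + |y| := by
      have := abs_add_le x (t - x)
      rw [add_sub_cancel] at this
      linarith
    have h := abs_rpow_mul_self_sub_le (e := q - 2) (by linarith) htR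
      (show |x| ≤ |x| + |y| by linarith [abs_nonneg y])
    have h0 : 0 ≤ (|x| + |y|) ^ (q - 2) := by positivity
    rw [Real.norm_eq_abs, mul_assoc, ← mul_sub, abs_mul, abs_of_pos (by linarith : 0 < q)]
    calc q * |(|t| ^ (q - 2) * t - |x| ^ (q - 2) * x)|
        ≤ q * ((q - 2 + 1) * (|x| + |y|) ^ (q - 2) * |t - x|) := by gcongr
      _ ≤ q * ((q - 2 + 1) * (|x| + |y|) ^ (q - 2) * |y|) := by
          have : 0 ≤ q - 2 + 1 := by linarith
          gcongr
      _ = _ := by ring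
  have h := (convex_segment x (x + y)).norm_image_sub_le_of_norm_hasDerivWithin_le
    hder hbound (left_mem_segment ℝ x (x + y)) (right_mem_segment ℝ x (x + y))
  have h2 := (le_abs_self _).trans h
  simp only [hg, add_sub_cancel_left, Real.norm_eq_abs] at h2
  have hR : (|x| + |y|) ^ (q - 2) ≤ 2 ^ (q - 2) * (|x| ^ (q - 2) + |y| ^ (q - 2)) := by
    have hq2 : 0 ≤ q - 2 := by linarith
    have h1 : |x| + |y| ≤ 2 * max |x| |y| := by
      linarith [le_max_left |x| |y|, le_max_right |x| |y|]
    refine (Real.rpow_le_rpow (by positivity) h1 hq2).trans ?_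
    rw [Real.mul_rpow (by norm_num) (by positivity)]
    gcongr
    rcases le_total |x| |y| with h | h
    · rw [max_eq_right h]; linarith [Real.rpow_nonneg (abs_nonneg x) (q - 2)]
    · rw [max_eq_left h]; linarith [Real.rpow_nonneg (abs_nonneg y) (q - 2)]
  have hy : |y| ^ (q - 2) * y ^ 2 = |y| ^ q := by
    rw [← sq_abs, ← Real.rpow_natCast, ← Real.rpow_add_of_nonneg (abs_nonneg _) (by linarith)
      (by norm_num)]
    norm_num
  have h3 : q * (q - 1) * (|x| + |y|) ^ (q - 2) * |y| * |y| ≤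
      q * (q - 1) * 2 ^ (q - 2) * (|x| ^ (q - 2) * y ^ 2 + |y| ^ q) := by
    rw [← hy, ← add_mul, mul_assoc _ |y| |y|, abs_mul_abs_self, ← pow_two]
    have : 0 ≤ q * (q - 1) := by nlinarith
    calc q * (q - 1) * (|x| + |y|) ^ (q - 2) * y ^ 2
        ≤ q * (q - 1) * (2 ^ (q - 2) * (|x| ^ (q - 2) + |y| ^ (q - 2))) * y ^ 2 := by gcongr
      _ = _ := by ring
  linarith

/-- Young-type splitting at `x² = u / θ`. The top power reappears with a factor `θ` that can be made
small, so the moment induction can absorb it. -/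
lemma abs_rpow_sub_two_le {k θ u x : ℝ} (hk : 1 < k) (hθ : 0 < θ) (hu : 0 < u) :
    |x| ^ (2 * k - 2) ≤ θ * u⁻¹ * |x| ^ (2 * k) + θ⁻¹ ^ (k - 1) * u ^ (k - 1) := by
  have hp1 : 0 ≤ |x| ^ (2 * k) := by positivity
  have hp2 : 0 ≤ θ⁻¹ ^ (k - 1) * u ^ (k - 1) := by positivity
  have hsplit : |x| ^ (2 * k - 2) * x ^ 2 = |x| ^ (2 * k) := by
    rw [← sq_abs, ← Real.rpow_natCast, ← Real.rpow_add_of_nonneg (abs_nonneg _) (by linarith)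
      (by norm_num)]
    norm_num
  have hp3 : 0 ≤ |x| ^ (2 * k - 2) := by positivity
  rcases le_total (θ⁻¹ * u) (x ^ 2) with h | h
  · have h1 : 1 ≤ θ * u⁻¹ * x ^ 2 := by
      calc (1 : ℝ) = θ * u⁻¹ * (θ⁻¹ * u) := by field_simp
        _ ≤ _ := by gcongr
    have : |x| ^ (2 * k - 2) ≤ θ * u⁻¹ * |x| ^ (2 * k) := by
      rw [← hsplit]; nlinarith
    linarith
  · have : |x| ^ (2 * k - 2) ≤ θ⁻¹ ^ (k - 1) * u ^ (k - 1) := by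
      rw [← Real.mul_rpow (by positivity) hu.le, show 2 * k - 2 = 2 * (k - 1) by ring,
        Real.rpow_mul (abs_nonneg _)]
      apply Real.rpow_le_rpow (by positivity) _ (by linarith)
      norm_num
      exact h
    have : 0 ≤ θ * u⁻¹ * |x| ^ (2 * k) := by positivity
    linarith

section ErrorModel

variable {Ω : Type*} [MeasurableSpace Ω] {μ : Measure Ω} {n : ℕ} {k σ M : ℝ} {ε : Fin n → Ω → ℝ}

lemma ErrorModel.precomp (h : ErrorModel μ k σ M ε) {r : ℕ} {g : Fin r → Fin n}
    (hg : g.Injective) : ErrorModel μ k σ M (fun l => ε (g l)) where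
  meas _ := h.meas _
  indep := h.indep.precomp hg
  sq_integrable _ := h.sq_integrable _
  mean _ := h.mean _
  var _ := h.var _
  moment_integrable _ := h.moment_integrable _
  moment_le _ := h.moment_le _

lemma ErrorModel.integral_sq (h : ErrorModel μ k σ M ε) (l : Fin n) :
    ∫ ω, ε l ω ^ 2 ∂μ = σ ^ 2 := by
  rw [← h.var l, variance_of_integral_eq_zero (h.meas l).aemeasurable (h.mean l)]

lemma ErrorModel.memLp_sum (h : ErrorModel μ k σ M ε) (a : Fin n → ℝ) :
    MemLp (fun ω => ∑ l, a l * ε l ω) 2 μ :=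
  memLp_finsetSum _ fun l _ => (h.sq_integrable l).const_mul _

lemma ErrorModel.integral_sum_sq (h : ErrorModel μ k σ M ε) (a : Fin n → ℝ) :
    ∫ ω, (∑ l, a l * ε l ω) ^ 2 ∂μ = σ ^ 2 * sqNorm a := by
  have := h.indep.isProbabilityMeasure
  have hmean : ∫ ω, ∑ l, a l * ε l ω ∂μ = 0 := by
    rw [integral_finsetSum _ fun l _ =>
      ((h.sq_integrable l).integrable (by norm_num)).const_mul _]
    simp [integral_const_mul, h.mean]
  rw [← variance_of_integral_eq_zero (h.memLp_sum a).aestronglyMeasurable.aemeasurable hmean]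
  have h1 : (fun ω => ∑ l, a l * ε l ω) = ∑ l, (fun ω => a l * ε l ω) := by
    ext ω; simp
  rw [h1, IndepFun.variance_sum]
  · simp_rw [variance_const_mul, h.var, sqNorm, Finset.mul_sum, mul_comm]
  · exact fun l _ => (h.sq_integrable l).const_mul _
  · intro i _ j _ hij
    exact (h.indep.indepFun hij).comp (φ := fun x => a i * x) (ψ := fun x => a j * x)
      (by fun_prop) (by fun_prop)

/-- A Marcinkiewicz–Zygmund type bound, proved by adding one summand at a time. The same `K` must
survive each step for the bound not to depend on `n`; the conditions on `θ` and `K` ensure this. -/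
lemma ErrorModel.sum_rpow_le [IsProbabilityMeasure μ] (h : ErrorModel μ k σ M ε) (hk : 1 < k)
    {c θ K : ℝ} (hc : c = 2 * k * (2 * k - 1) * 2 ^ (2 * k - 2)) (hθ : 0 < θ)
    (hθc : c * θ * σ ^ 2 ≤ 1 / 4) (hK : 4 * c * θ⁻¹ ^ (k - 1) * σ ^ 2 ≤ K)
    (hK' : 2 * c * M ≤ K) (hKM : M ≤ K) (hK0 : 0 ≤ K) (a : Fin n → ℝ) (s : Finset (Fin n)) :
    ∫ ω, |∑ l ∈ s, a l * ε l ω| ^ (2 * k) ∂μ ≤ K * (∑ l ∈ s, a l ^ 2) ^ k := by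
  have hc0 : 0 ≤ c := by
    rw [hc]
    have : 0 ≤ 2 * k * (2 * k - 1) := by nlinarith
    positivity
  have hp0 : ENNReal.ofReal (2 * k) ≠ 0 := by simpa using by linarith
  have hpT : (ENNReal.ofReal (2 * k)).toReal = 2 * k := ENNReal.toReal_ofReal (by linarith)
  have hmem : ∀ l, MemLp (ε l) (ENNReal.ofReal (2 * k)) μ := fun l => by
    rw [← integrable_norm_rpow_iff (h.meas l).aestronglyMeasurable hp0 ENNReal.ofReal_ne_top, hpT]
    exact h.moment_integrable l
  have hmemS : ∀ s : Finset (Fin n),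
      MemLp (fun ω => ∑ l ∈ s, a l * ε l ω) (ENNReal.ofReal (2 * k)) μ := fun s =>
    memLp_finsetSum s fun l _ => (hmem l).const_mul _
  have hint : ∀ s : Finset (Fin n),
      Integrable (fun ω => |∑ l ∈ s, a l * ε l ω| ^ (2 * k)) μ := fun s => by
    have := (hmemS s).integrable_norm_rpow'
    rwa [hpT] at this
  have hmeasS : ∀ s : Finset (Fin n), Measurable fun ω => ∑ l ∈ s, a l * ε l ω := fun s => by
    have := h.meas
    fun_prop
  have hmom : ∀ l, ∫ ω, |a l * ε l ω| ^ (2 * k) ∂μ ≤ M * (a l ^ 2) ^ k := fun l => by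
    have h1 : ∀ ω, |a l * ε l ω| ^ (2 * k) = (a l ^ 2) ^ k * |ε l ω| ^ (2 * k) := fun ω => by
      rw [abs_mul, Real.mul_rpow (abs_nonneg _) (abs_nonneg _), Real.rpow_mul (abs_nonneg (a l))]
      norm_num
    simp_rw [h1]
    rw [integral_const_mul, mul_comm]
    exact mul_le_mul_of_nonneg_right (h.moment_le l) (by positivity)
  induction s using Finset.induction_on with
  | empty => simp [Real.zero_rpow (by linarith : 2 * k ≠ 0), Real.zero_rpow (by linarith : k ≠ 0)]
  | insert j s hj ih =>
    simp only [Finset.sum_insert hj]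
    set x : Ω → ℝ := fun ω => ∑ l ∈ s, a l * ε l ω with hx
    set u : ℝ := ∑ l ∈ s, a l ^ 2 with hu
    have hu0 : 0 ≤ u := Finset.sum_nonneg fun l _ => sq_nonneg _
    -- The splitting scale involves `u⁻¹`, so vanishing weights are treated separately.
    rcases hu0.eq_or_lt with hu1 | hu1
    · have hz : ∀ l ∈ s, a l = 0 := fun l hl => by
        have := (Finset.sum_eq_zero_iff_of_nonneg (fun l _ => sq_nonneg (a l))).1 hu1.symm l hl
        simpa using this
      have hxz : ∀ ω, x ω = 0 := fun ω => Finset.sum_eq_zero fun l hl => by simp [hz l hl]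
      have : ∀ ω, |a j * ε j ω + ∑ l ∈ s, a l * ε l ω| = |a j * ε j ω| := fun ω => by
        have := hxz ω
        simp only [hx] at this
        rw [this, add_zero]
      simp_rw [this]
      rw [← hu1, add_zero]
      exact (hmom j).trans (by gcongr)
    · have hq : 2 < 2 * k := by linarith
      have hindep : IndepFun x (ε j) μ := by
        have hs := h.indep.indepFun_finset s {j} (by simpa using hj) h.meas
        have hm : Measurable (fun v : ({j} : Finset (Fin n)) → ℝ => v ⟨j, by simp⟩) := by fun_prop
        have h3 := hs.comp (φ := fun v : s → ℝ => ∑ l : s, a l * v l) (by fun_prop) hm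
        convert h3 using 1
        · ext ω
          simp only [hx, Function.comp]
          exact (Finset.sum_coe_sort s (fun l => a l * ε l ω)).symm
        · rfl
      have hI1 : Integrable (fun ω => |x ω| ^ (2 * k - 2) * x ω) μ := by
        have h1 : MemLp x (ENNReal.ofReal (2 * k - 1)) μ :=
          (hmemS s).mono_exponent (ENNReal.ofReal_le_ofReal (by linarith))
        have h2 := h1.integrable_norm_rpow'
        rw [ENNReal.toReal_ofReal (by linarith)] at h2
        refine h2.mono' ?_ (Filter.Eventually.of_forall fun ω => ?_)
        · have := hmeasS s
          exact Measurable.aestronglyMeasurable (by fun_prop)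
        · rw [norm_mul, Real.norm_eq_abs, Real.norm_eq_abs,
            abs_of_nonneg (Real.rpow_nonneg (abs_nonneg (x ω)) _),
            ← Real.rpow_add_one' (abs_nonneg _) (by linarith)]
          ring_nf
          rfl
      have hI2 : Integrable (fun ω => |x ω| ^ (2 * k - 2)) μ := by
        have h1 : MemLp x (ENNReal.ofReal (2 * k - 2)) μ :=
          (hmemS s).mono_exponent (ENNReal.ofReal_le_ofReal (by linarith))
        have h2 := h1.integrable_norm_rpow'
        rwa [ENNReal.toReal_ofReal (by linarith)] at h2
      have hsq : Integrable (fun ω => ε j ω ^ 2) μ := (h.sq_integrable j).integrable_sq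
      have hεI : Integrable (ε j) μ := (h.sq_integrable j).integrable (by norm_num)
      have hind1 : IndepFun (fun ω => |x ω| ^ (2 * k - 2) * x ω) (ε j) μ :=
        hindep.comp (φ := fun t : ℝ => |t| ^ (2 * k - 2) * t) (ψ := id) (by fun_prop) (by fun_prop)
      have hind2 : IndepFun (fun ω => |x ω| ^ (2 * k - 2)) (fun ω => ε j ω ^ 2) μ :=
        hindep.comp (φ := fun t : ℝ => |t| ^ (2 * k - 2)) (ψ := fun t => t ^ 2)
          (by fun_prop) (by fun_prop)
      have hP1 : Integrable (fun ω => (|x ω| ^ (2 * k - 2) * x ω) * ε j ω) μ :=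
        hind1.integrable_mul hI1 hεI
      have hP2 : Integrable (fun ω => |x ω| ^ (2 * k - 2) * ε j ω ^ 2) μ :=
        hind2.integrable_mul hI2 hsq
      have hE1 : ∫ ω, (|x ω| ^ (2 * k - 2) * x ω) * ε j ω ∂μ = 0 := by
        rw [hind1.integral_fun_mul_eq_mul_integral hI1.aestronglyMeasurable
          hεI.aestronglyMeasurable, h.mean, mul_zero]
      have hxI : Integrable (fun ω => |x ω| ^ (2 * k)) μ := hint s
      have hE2 : ∫ ω, |x ω| ^ (2 * k - 2) * ε j ω ^ 2 ∂μ ≤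
          (θ * K + θ⁻¹ ^ (k - 1)) * u ^ (k - 1) * σ ^ 2 := by
        rw [hind2.integral_fun_mul_eq_mul_integral hI2.aestronglyMeasurable
          hsq.aestronglyMeasurable, h.integral_sq]
        refine mul_le_mul_of_nonneg_right ?_ (sq_nonneg _)
        calc ∫ ω, |x ω| ^ (2 * k - 2) ∂μ
            ≤ ∫ ω, (θ * u⁻¹ * |x ω| ^ (2 * k) + θ⁻¹ ^ (k - 1) * u ^ (k - 1)) ∂μ :=
              integral_mono hI2 ((hxI.const_mul _).add (integrable_const _))
                fun ω => abs_rpow_sub_two_le hk hθ hu1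
          _ = θ * u⁻¹ * ∫ ω, |x ω| ^ (2 * k) ∂μ + θ⁻¹ ^ (k - 1) * u ^ (k - 1) := by
              rw [integral_add (hxI.const_mul _) (integrable_const _), integral_const_mul]
              simp
          _ ≤ θ * u⁻¹ * (K * u ^ k) + θ⁻¹ ^ (k - 1) * u ^ (k - 1) := by gcongr
          _ = _ := by
              rw [Real.rpow_sub_one hu1.ne']
              field_simp
      have hyI : Integrable (fun ω => |a j * ε j ω| ^ (2 * k)) μ := by
        simpa using hint {j}
      have hL : Integrable (fun ω => |x ω| ^ (2 * k) +
          (2 * k * a j) * ((|x ω| ^ (2 * k - 2) * x ω) * ε j ω)) μ := hxI.add (hP1.const_mul _)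
      have hR : Integrable (fun ω => a j ^ 2 * (|x ω| ^ (2 * k - 2) * ε j ω ^ 2) +
          |a j * ε j ω| ^ (2 * k)) μ := (hP2.const_mul _).add hyI
      have hgoal : ∫ ω, |a j * ε j ω + ∑ l ∈ s, a l * ε l ω| ^ (2 * k) ∂μ ≤
          K * u ^ k + c * (a j ^ 2 * ((θ * K + θ⁻¹ ^ (k - 1)) * u ^ (k - 1) * σ ^ 2) +
            M * (a j ^ 2) ^ k) := by
        calc ∫ ω, |a j * ε j ω + ∑ l ∈ s, a l * ε l ω| ^ (2 * k) ∂μ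
            ≤ ∫ ω, (|x ω| ^ (2 * k) + (2 * k * a j) * ((|x ω| ^ (2 * k - 2) * x ω) * ε j ω) +
                c * (a j ^ 2 * (|x ω| ^ (2 * k - 2) * ε j ω ^ 2) +
                  |a j * ε j ω| ^ (2 * k))) ∂μ := by
              refine integral_mono ?_ (hL.add (hR.const_mul _)) fun ω => ?_
              · have := hint (insert j s)
                simpa only [Finset.sum_insert hj] using this
              · have := abs_add_rpow_le hq (x ω) (a j * ε j ω)
                rw [add_comm (a j * ε j ω)]
                refine this.trans (le_of_eq ?_)
                rw [← hc]
                ring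
          _ = ∫ ω, |x ω| ^ (2 * k) ∂μ +
                (2 * k * a j) * ∫ ω, (|x ω| ^ (2 * k - 2) * x ω) * ε j ω ∂μ +
                c * (a j ^ 2 * ∫ ω, |x ω| ^ (2 * k - 2) * ε j ω ^ 2 ∂μ +
                  ∫ ω, |a j * ε j ω| ^ (2 * k) ∂μ) := by
              rw [integral_add hL (hR.const_mul _),
                integral_add hxI (hP1.const_mul _), integral_const_mul, integral_const_mul,
                integral_add (hP2.const_mul _) hyI, integral_const_mul]
          _ ≤ _ := by
              rw [hE1, mul_zero, add_zero]
              gcongr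
              exact hmom j
      refine hgoal.trans ?_
      -- The increment consists of a cross term and a pure term, each with coefficient at most `K /
      -- 2`; the average of `hb1` and `hb2` pays for both.
      have hb1 : u ^ k + (a j ^ 2) ^ k ≤ (a j ^ 2 + u) ^ k := by
        rw [add_comm (a j ^ 2)]
        exact Real.add_rpow_le_rpow_add hu0 (sq_nonneg _) hk.le
      have hb2 : u ^ k + u ^ (k - 1) * a j ^ 2 ≤ (a j ^ 2 + u) ^ k := by
        have h1 : (a j ^ 2 + u) ^ k = (a j ^ 2 + u) ^ (k - 1) * (a j ^ 2 + u) := by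
          rw [← Real.rpow_add_one (by positivity)]; ring_nf
        have h2 : u ^ k = u ^ (k - 1) * u := by
          rw [← Real.rpow_add_one hu1.ne']; ring_nf
        have h3 : u ^ (k - 1) ≤ (a j ^ 2 + u) ^ (k - 1) :=
          Real.rpow_le_rpow hu0 (by nlinarith) (by linarith)
        rw [h1, h2]
        nlinarith [sq_nonneg (a j)]
      have hw : 0 ≤ u ^ (k - 1) * a j ^ 2 := by positivity
      have hv : 0 ≤ (a j ^ 2) ^ k := by positivity
      have h1 : c * (a j ^ 2 * ((θ * K + θ⁻¹ ^ (k - 1)) * u ^ (k - 1) * σ ^ 2)) ≤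
          K / 2 * (u ^ (k - 1) * a j ^ 2) := by
        have : c * (a j ^ 2 * ((θ * K + θ⁻¹ ^ (k - 1)) * u ^ (k - 1) * σ ^ 2)) =
          (c * θ * σ ^ 2 * K + c * θ⁻¹ ^ (k - 1) * σ ^ 2) * (u ^ (k - 1) * a j ^ 2) := by ring
        rw [this]
        refine mul_le_mul_of_nonneg_right ?_ hw
        nlinarith
      have h2 : c * M * (a j ^ 2) ^ k ≤ K / 2 * (a j ^ 2) ^ k :=
        mul_le_mul_of_nonneg_right (by linarith) hv
      nlinarith

/-- Polynomial tail bound, uniform over all error models with the given moments. -/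
lemma exists_tail_bound (k σ M : ℝ) (hk : 0 < k) :
    ∃ K : ℝ, 0 < K ∧ ∀ {Ω : Type*} [MeasurableSpace Ω] (μ : Measure Ω) [IsProbabilityMeasure μ]
      {n : ℕ} (ε : Fin n → Ω → ℝ), ErrorModel μ k σ M ε → ∀ (a : Fin n → ℝ) (t : ℝ), 0 < t →
      μ.real {ω | t ≤ |∑ l, a l * ε l ω|} ≤ K * (sqNorm a / t ^ 2) ^ k := by
  rcases le_or_gt k 1 with hk1 | hk1
  · refine ⟨(σ ^ 2) ^ k + 1, by positivity, fun {Ω} _ μ _ {n} ε h a t ht => ?_⟩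
    have ha : 0 ≤ sqNorm a := Finset.sum_nonneg fun _ _ => sq_nonneg _
    have h1 := mul_meas_ge_le_integral_of_nonneg (μ := μ)
      (f := fun ω => (∑ l, a l * ε l ω) ^ 2) (Filter.Eventually.of_forall fun ω => sq_nonneg _)
      (h.memLp_sum a).integrable_sq (t ^ 2)
    rw [h.integral_sum_sq] at h1
    have h2 : {ω | t ≤ |∑ l, a l * ε l ω|} = {ω | t ^ 2 ≤ (∑ l, a l * ε l ω) ^ 2} := by
      ext ω
      simp only [Set.mem_ofPred_eq]
      rw [← sq_abs (∑ l, a l * ε l ω), pow_le_pow_iff_left₀ ht.le (abs_nonneg _) two_ne_zero]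
    rw [h2]
    set P := μ.real {ω | t ^ 2 ≤ (∑ l, a l * ε l ω) ^ 2} with hP
    have hP0 : 0 ≤ P := measureReal_nonneg
    have hP1 : P ≤ 1 := measureReal_le_one
    have h3 : P ≤ σ ^ 2 * (sqNorm a / t ^ 2) := by
      rw [← mul_div_assoc, le_div_iff₀ (by positivity)]
      linarith
    -- For `k ≤ 1` Chebyshev suffices, since a number in `[0, 1]` is at most its `k`-th power.
    have h4 : P ≤ P ^ k := by
      rcases hP0.eq_or_lt with h | h
      · rw [← h, Real.zero_rpow hk.ne']
      · calc P = P ^ (1 : ℝ) := (Real.rpow_one _).symm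
          _ ≤ _ := Real.rpow_le_rpow_of_exponent_ge h hP1 hk1
    calc P ≤ P ^ k := h4
      _ ≤ (σ ^ 2 * (sqNorm a / t ^ 2)) ^ k := Real.rpow_le_rpow hP0 h3 hk.le
      _ = (σ ^ 2) ^ k * (sqNorm a / t ^ 2) ^ k := Real.mul_rpow (by positivity) (by positivity)
      _ ≤ _ := by gcongr; linarith
  · set c := 2 * k * (2 * k - 1) * 2 ^ (2 * k - 2) with hc
    have hc0 : 0 < c := by
      have : 0 < 2 * k * (2 * k - 1) := by nlinarith
      positivity
    -- Gives `c θ σ² ≤ 1/4`; the added 1 keeps `θ` positive when `σ = 0`.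
    set θ : ℝ := 1 / (4 * c * (σ ^ 2 + 1)) with hθ
    have hθ0 : 0 < θ := by positivity
    set K : ℝ := 4 * c * θ⁻¹ ^ (k - 1) * σ ^ 2 + 2 * c * |M| + |M| + 1 with hK
    have e1 : 0 ≤ 4 * c * θ⁻¹ ^ (k - 1) * σ ^ 2 := by positivity
    have e2 : 0 ≤ 2 * c * |M| := by positivity
    have e3 : 2 * c * M ≤ 2 * c * |M| := by gcongr; exact le_abs_self M
    have e4 := le_abs_self M
    have e5 := abs_nonneg M
    refine ⟨K, by positivity, fun {Ω} _ μ _ {n} ε h a t ht => ?_⟩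
    have ha : 0 ≤ sqNorm a := Finset.sum_nonneg fun _ _ => sq_nonneg _
    have h0 := h.sum_rpow_le hk1 hc hθ0
      (by rw [hθ]
          rw [mul_one_div, div_mul_eq_mul_div, div_le_iff₀ (by positivity)]
          nlinarith [sq_nonneg σ]) (K := K) (by linarith) (by linarith) (by linarith)
      (by linarith) a Finset.univ
    have hint : Integrable (fun ω => |∑ l, a l * ε l ω| ^ (2 * k)) μ := by
      have hpT : (ENNReal.ofReal (2 * k)).toReal = 2 * k := ENNReal.toReal_ofReal (by linarith)
      have : MemLp (fun ω => ∑ l, a l * ε l ω) (ENNReal.ofReal (2 * k)) μ :=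
        memLp_finsetSum _ fun l _ => MemLp.const_mul (by
          rw [← integrable_norm_rpow_iff (h.meas l).aestronglyMeasurable
            (by simpa using by linarith) ENNReal.ofReal_ne_top, hpT]
          exact h.moment_integrable l) _
      have := this.integrable_norm_rpow'
      rwa [hpT] at this
    have h1 := mul_meas_ge_le_integral_of_nonneg (μ := μ)
      (Filter.Eventually.of_forall fun ω => by positivity) hint (t ^ (2 * k))
    have h2 : {ω | t ≤ |∑ l, a l * ε l ω|} =
        {ω | t ^ (2 * k) ≤ |∑ l, a l * ε l ω| ^ (2 * k)} := by
      ext ω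
      simp only [Set.mem_ofPred_eq]
      rw [Real.rpow_le_rpow_iff ht.le (abs_nonneg _) (by linarith)]
    rw [h2, Real.div_rpow ha (by positivity), ← mul_div_assoc, le_div_iff₀ (by positivity)]
    have h3 : (t ^ 2) ^ k = t ^ (2 * k) := by
      rw [Real.rpow_mul ht.le]; norm_num
    rw [h3, mul_comm]
    exact h1.trans h0

end ErrorModel

/-! ### Majority vote over independent blocks -/

section Majority

variable {Ω : Type*} [MeasurableSpace Ω] {μ : Measure Ω} {m : ℕ}

/-- The joint law of the errors is a product measure, and currying it yields the product over blocks
of the block laws. -/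
lemma iIndepFun_blocks {n r : ℕ} {ε : Fin n → Ω → ℝ} (hε : iIndepFun ε μ)
    (hm : ∀ l, Measurable (ε l)) (e : Fin n ≃ Fin m × Fin r) :
    iIndepFun (fun (i : Fin m) ω (l : Fin r) => ε (e.symm (i, l)) ω) μ := by
  have := hε.isProbabilityMeasure
  have hprob : ∀ l, IsProbabilityMeasure (μ.map (ε l)) := fun l =>
    Measure.isProbabilityMeasure_map (hm l).aemeasurable
  have h1 : iIndepFun (fun q : Fin m × Fin r => ε (e.symm q)) μ := hε.precomp e.symm.injective
  have h2 := h1.map_fun_eq_infinitePi_map (fun q => hm _)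
  have h3 := congrArg (fun ν => ν.map (MeasurableEquiv.curry (Fin m) (Fin r) ℝ)) h2
  beta_reduce at h3
  rw [Measure.map_map (by fun_prop) (by fun_prop),
    Measure.infinitePi_map_curry (fun i j => μ.map (ε (e.symm (i, j))))] at h3
  rw [iIndepFun_iff_map_fun_eq_infinitePi_map (by fun_prop)]
  refine Eq.trans ?_ (h3.trans ?_)
  · rfl
  · congr 1
    ext1 i
    have h4 : iIndepFun (fun l : Fin r => ε (e.symm (i, l))) μ :=
      hε.precomp (g := fun l : Fin r => e.symm (i, l)) fun a b hab => by simpa using hab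
    exact (h4.map_fun_eq_infinitePi_map (fun l => hm _)).symm

open Classical in
lemma measurableSet_majority {E : Type*} [MeasurableSpace E] {W : Fin m → Ω → E}
    (hWm : ∀ j, Measurable (W j)) {A : Fin m → Set E} (hA : ∀ j, MeasurableSet (A j)) :
    MeasurableSet {ω | m ≤ 2 * (Finset.univ.filter fun j => W j ω ∈ A j).card} := by
  refine measurableSet_le measurable_const (Measurable.const_mul ?_ 2)
  simp_rw [Finset.card_filter]
  exact Finset.measurable_fun_sum _ fun j _ =>
    Measurable.ite (hWm j (hA j)) measurable_const measurable_const

open Classical in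
-- A union bound over the sets `T` of failing blocks with `2 |T| ≥ m`, carrying the weight `z` of
-- block `i`. Independence factorizes the integral; `h1` or `h2` handles the factor `i`, according
-- to whether `i ∈ T`. Writing the failure bound as `s ^ 2` turns `s ^ (2 |T|)` into at most `s ^
-- m`.
lemma setLIntegral_majority_le {E : Type*} [MeasurableSpace E] {W : Fin m → Ω → E}
    (hW : iIndepFun W μ) (hWm : ∀ j, Measurable (W j)) {A : Fin m → Set E}
    (hA : ∀ j, MeasurableSet (A j)) {z : E → ℝ≥0∞} (hz : Measurable z) (i : Fin m)
    {s v : ℝ≥0∞} (hs : s ≤ 1) (hP : ∀ j, μ (W j ⁻¹' A j) ≤ s ^ 2)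
    (h1 : ∫⁻ ω in W i ⁻¹' A i, z (W i ω) ∂μ ≤ s ^ 2 * v) (h2 : ∫⁻ ω, z (W i ω) ∂μ ≤ v) :
    ∫⁻ ω in {ω | m ≤ 2 * (Finset.univ.filter fun j => W j ω ∈ A j).card}, z (W i ω) ∂μ ≤
      (2 * s) ^ m * v := by
  have := hW.isProbabilityMeasure
  set g : Finset (Fin m) → Fin m → E → ℝ≥0∞ := fun T j x =>
    (if j = i then z x else 1) * (if j ∈ T then (A j).indicator 1 x else 1) with hg
  have hgm : ∀ T j, Measurable (g T j) := by
    intro T j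
    refine Measurable.mul ?_ ?_
    · split_ifs
      · exact hz
      · exact measurable_const
    · split_ifs
      · exact measurable_one.indicator (hA j)
      · exact measurable_const
  have hind : ∀ T, iIndepFun (fun j ω => g T j (W j ω)) μ := fun T =>
    hW.comp (g T) (hgm T)
  have hbound : ∀ T j, ∫⁻ ω, g T j (W j ω) ∂μ ≤
      (if j = i then v else 1) * (if j ∈ T then s ^ 2 else 1) := by
    intro T j
    have hpre : ∀ ω, (A j).indicator (1 : E → ℝ≥0∞) (W j ω) =
        (W j ⁻¹' A j).indicator 1 ω := fun ω => rfl
    by_cases hji : j = i <;> by_cases hjT : j ∈ T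
    · subst hji
      simp only [hg, if_true, hjT]
      rw [mul_comm v]
      refine le_trans (le_of_eq ?_) h1
      rw [← lintegral_indicator (hWm j (hA j))]
      refine lintegral_congr fun ω => ?_
      by_cases hω : W j ω ∈ A j <;> simp [Set.indicator, hω]
    · subst hji
      simpa [hg, hjT] using h2
    · simp only [hg, hji, hjT, if_true, if_false, one_mul, hpre]
      rw [lintegral_indicator_one (hWm j (hA j))]
      exact hP j
    · simp [hg, hji, hjT]
  set B : Set Ω := {ω | m ≤ 2 * (Finset.univ.filter fun j => W j ω ∈ A j).card} with hB
  have hBm : MeasurableSet B := measurableSet_majority hWm hA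
  set 𝒯 : Finset (Finset (Fin m)) := Finset.univ.filter fun T => m ≤ 2 * T.card with h𝒯
  calc ∫⁻ ω in B, z (W i ω) ∂μ
      ≤ ∫⁻ ω, B.indicator (fun ω => z (W i ω)) ω ∂μ := (lintegral_indicator hBm _).ge
    _ ≤ ∫⁻ ω, ∑ T ∈ 𝒯, ∏ j, g T j (W j ω) ∂μ := by
        refine lintegral_mono fun ω => ?_
        by_cases hω : ω ∈ B
        · rw [Set.indicator_of_mem hω]
          set T := Finset.univ.filter fun j => W j ω ∈ A j with hT
          have hTm : T ∈ 𝒯 := Finset.mem_filter.2 ⟨Finset.mem_univ _, hω⟩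
          refine le_trans (le_of_eq ?_) (Finset.single_le_sum
            (f := fun T => ∏ j, g T j (W j ω)) (fun _ _ => zero_le) hTm)
          have h3 : ∀ j, g T j (W j ω) = if j = i then z (W i ω) else 1 := by
            intro j
            have : (if j ∈ T then (A j).indicator (1 : E → ℝ≥0∞) (W j ω) else 1) = 1 := by
              split_ifs with h
              · have : W j ω ∈ A j := by simpa [hT] using h
                simp [this]
              · rfl
            simp only [hg, this, mul_one]
            split_ifs with h
            · rw [h]
            · rfl
          simp [h3]
        · simp [Set.indicator_of_notMem hω]
    _ = ∑ T ∈ 𝒯, ∏ j, ∫⁻ ω, g T j (W j ω) ∂μ := by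
        have hmeas : ∀ T ∈ 𝒯, Measurable fun ω => ∏ j, g T j (W j ω) := fun T _ =>
          Finset.measurable_fun_prod _ fun j _ => (hgm T j).comp (hWm j)
        rw [lintegral_finsetSum _ hmeas]
        refine Finset.sum_congr rfl fun T _ => ?_
        exact lintegral_prod_eq_prod_lintegral_of_indepFun _ _ (hind T)
          fun j => (hgm T j).comp (hWm j)
    _ ≤ ∑ T ∈ 𝒯, s ^ m * v := by
        refine Finset.sum_le_sum fun T hT => ?_
        refine (Finset.prod_le_prod' fun j _ => hbound T j).trans ?_
        rw [Finset.prod_mul_distrib]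
        have e1 : ∏ j, (if j = i then v else 1) = v := by simp
        have e2 : ∏ j, (if j ∈ T then s ^ 2 else 1) = s ^ (2 * T.card) := by
          rw [Finset.prod_ite_mem, Finset.univ_inter, Finset.prod_const, pow_mul]
        rw [e1, e2, mul_comm]
        have : m ≤ 2 * T.card := by simpa [h𝒯] using hT
        exact mul_le_mul' (pow_le_pow_of_le_one zero_le hs this) le_rfl
    _ = (𝒯.card : ℝ≥0∞) * (s ^ m * v) := by rw [Finset.sum_const, nsmul_eq_mul]
    _ ≤ (2 ^ m : ℝ≥0∞) * (s ^ m * v) := by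
        gcongr
        have : 𝒯.card ≤ 2 ^ m := by
          refine (Finset.card_le_univ 𝒯).trans ?_
          simp
        exact_mod_cast this
    _ = (2 * s) ^ m * v := by rw [mul_pow, mul_assoc]

end Majority

/-- Compare `G` with the competitor `S`. With `d` the distance from `G` to `S`, replacing `G` by `S`
gains `d` on every block outside `B` and, by the triangle inequality, loses at most `d` on every
block in `B`. -/
lemma IsMedianModel.eq_of_majority {p m : ℕ} {γ : Fin m → Finset (Fin p)} {G S : Finset (Fin p)}
    (h : IsMedianModel γ G) {B : Finset (Fin m)} (hB : ∀ i ∉ B, γ i = S) (hcard : 2 * B.card < m) :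
    G = S := by
  by_contra hne
  have hd : 0 < (symmDiff G S).card := by
    rw [Finset.card_pos, Finset.nonempty_iff_ne_empty]
    simpa [symmDiff_eq_bot] using hne
  set d := (symmDiff G S).card
  have h1 := h S
  have key' : ∀ i, (d : ℤ) + (symmDiff S (γ i)).card ≤
      (symmDiff G (γ i)).card + if i ∈ B then (2 * d : ℤ) else 0 := by
    intro i
    split_ifs with hi
    · have htri : symmDiff S (γ i) ⊆ symmDiff S G ∪ symmDiff G (γ i) := symmDiff_triangle _ _ _
      have := (Finset.card_le_card htri).trans (Finset.card_union_le _ _)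
      rw [symmDiff_comm S G] at this
      omega
    · simp [hB i hi, d]
  have hsum := Finset.sum_le_sum fun i (_ : i ∈ Finset.univ) => key' i
  rw [Finset.sum_add_distrib, Finset.sum_add_distrib, Finset.sum_ite_mem, Finset.univ_inter,
    Finset.sum_const, Finset.sum_const, Finset.card_univ, Fintype.card_fin] at hsum
  have h2 : (∑ i, ((symmDiff G (γ i)).card : ℤ)) ≤ ∑ i, ((symmDiff S (γ i)).card : ℤ) := by
    exact_mod_cast h1
  have h3 : (m : ℤ) * d ≤ B.card * (2 * d) := by
    simp only [nsmul_eq_mul] at hsum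
    linarith
  have h4 : (2 * B.card : ℤ) < m := by exact_mod_cast hcard
  have h5 : (0 : ℤ) < d := by exact_mod_cast hd
  nlinarith

/-! ### Least squares in a submodel -/

section LeastSquares

open Matrix

variable {r p : ℕ}

lemma sqNorm_eq_dotProduct {κ : Type*} [Fintype κ] (v : κ → ℝ) : sqNorm v = v ⬝ᵥ v := by
  simp [sqNorm, dotProduct, pow_two]

lemma sqNorm_nonneg {κ : Type*} [Fintype κ] (v : κ → ℝ) : 0 ≤ sqNorm v :=
  Finset.sum_nonneg fun _ _ => sq_nonneg _

lemma sq_le_sqNorm {κ : Type*} [Fintype κ] (v : κ → ℝ) (j : κ) : v j ^ 2 ≤ sqNorm v :=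
  Finset.single_le_sum (f := fun j => v j ^ 2) (fun _ _ => sq_nonneg _) (Finset.mem_univ j)

lemma dotProduct_sq_le {κ : Type*} [Fintype κ] (v w : κ → ℝ) :
    (v ⬝ᵥ w) ^ 2 ≤ sqNorm v * sqNorm w :=
  Finset.sum_mul_sq_le_sq_mul_sq _ _ _

lemma sqNorm_eq_zero {κ : Type*} [Fintype κ] {v : κ → ℝ} (h : sqNorm v = 0) : v = 0 := by
  rwa [sqNorm_eq_dotProduct, dotProduct_self_eq_zero] at h

/-- Extension of a coefficient vector of the model `G` by zero. -/
noncomputable def extendZero {G : Finset (Fin p)} (v : G → ℝ) : Fin p → ℝ :=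
  fun j => if h : j ∈ G then v ⟨j, h⟩ else 0

lemma cols_mulVec (X : Matrix (Fin r) (Fin p) ℝ) {G : Finset (Fin p)} (v : G → ℝ) :
    cols X G *ᵥ v = X *ᵥ extendZero v := by
  ext l
  simp only [mulVec, dotProduct, cols, submatrix_apply, id]
  rw [← Finset.sum_subset (Finset.subset_univ G), ← Finset.sum_coe_sort G]
  · refine Finset.sum_congr rfl fun j _ => ?_
    simp [extendZero]
  · intro j _ hj
    simp [extendZero, hj]

lemma gram_isHermitian (X : Matrix (Fin r) (Fin p) ℝ) (G : Finset (Fin p)) :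
    (gram X G).IsHermitian := by
  simp [Matrix.IsHermitian, gram, conjTranspose_eq_transpose_of_trivial, transpose_mul]

lemma dotProduct_gram_mulVec (X : Matrix (Fin r) (Fin p) ℝ) {G : Finset (Fin p)} (v w : G → ℝ) :
    v ⬝ᵥ (gram X G *ᵥ w) = (cols X G *ᵥ v) ⬝ᵥ (cols X G *ᵥ w) := by
  rw [gram, ← mulVec_mulVec, dotProduct_mulVec, vecMul_transpose]

/-- Passes from the spectrum to the quadratic form: the matrix minus `c` has nonnegative spectrum,
hence is positive semidefinite. -/
lemma MinEigenvalueGE.mul_sqNorm_le {X : Matrix (Fin r) (Fin p) ℝ} {G : Finset (Fin p)} {c : ℝ}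
    (hr : 0 < r) (h : MinEigenvalueGE ((1 / (r : ℝ)) • gram X G) c) (v : G → ℝ) :
    r * c * sqNorm v ≤ sqNorm (cols X G *ᵥ v) := by
  have hr' : (0 : ℝ) < r := by exact_mod_cast hr
  have hH : ((1 / (r : ℝ)) • gram X G).IsHermitian := by
    rw [Matrix.IsHermitian, conjTranspose_smul, gram_isHermitian]
    simp
  have hpsd : ((1 / (r : ℝ)) • gram X G - algebraMap ℝ _ c).PosSemidef := by
    rw [posSemidef_iff_isHermitian_and_spectrum_nonneg]
    refine ⟨hH.sub ?_, ?_⟩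
    · rw [Matrix.IsHermitian, algebraMap_eq_diagonal, diagonal_conjTranspose]
      congr 1
    · intro t ht
      rw [← spectrum.sub_singleton_eq] at ht
      obtain ⟨t', ht', c', hc', rfl⟩ := ht
      rw [Set.mem_singleton_iff] at hc'
      subst hc'
      exact sub_nonneg.2 (h t' ht')
  have h1 := hpsd.dotProduct_mulVec_nonneg v
  rw [star_trivial, sub_mulVec, dotProduct_sub, smul_mulVec, dotProduct_smul,
    dotProduct_gram_mulVec, Algebra.algebraMap_eq_smul_one, smul_mulVec, one_mulVec,
    dotProduct_smul, ← sqNorm_eq_dotProduct, ← sqNorm_eq_dotProduct, smul_eq_mul, smul_eq_mul,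
    sub_nonneg, one_div, inv_mul_eq_div, le_div_iff₀ hr'] at h1
  linarith

variable {X : Matrix (Fin r) (Fin p) ℝ} {G : Finset (Fin p)} {c : ℝ}

lemma MinEigenvalueGE.isUnit_det_gram (hr : 0 < r) (hc : 0 < c)
    (h : MinEigenvalueGE ((1 / (r : ℝ)) • gram X G) c) : IsUnit (gram X G).det := by
  have hr' : (0 : ℝ) < r := by exact_mod_cast hr
  rw [← isUnit_iff_isUnit_det, ← mulVec_injective_iff_isUnit]
  intro v w hvw
  have h0 : gram X G *ᵥ (v - w) = 0 := by rw [mulVec_sub]; exact sub_eq_zero.2 hvw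
  have h1 := h.mul_sqNorm_le hr (v - w)
  rw [sqNorm_eq_dotProduct (cols X G *ᵥ (v - w)), ← dotProduct_gram_mulVec, h0,
    dotProduct_zero] at h1
  have h2 : sqNorm (v - w) = 0 := by
    have := sqNorm_nonneg (v - w)
    have := mul_pos hr' hc
    nlinarith
  exact sub_eq_zero.1 (sqNorm_eq_zero h2)

lemma MinEigenvalueGE.gram_mulVec_inv (hr : 0 < r) (hc : 0 < c)
    (h : MinEigenvalueGE ((1 / (r : ℝ)) • gram X G) c) (v : G → ℝ) :
    gram X G *ᵥ ((gram X G)⁻¹ *ᵥ v) = v := by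
  rw [mulVec_mulVec, mul_nonsing_inv _ (h.isUnit_det_gram hr hc), one_mulVec]

lemma MinEigenvalueGE.inv_mulVec_gram (hr : 0 < r) (hc : 0 < c)
    (h : MinEigenvalueGE ((1 / (r : ℝ)) • gram X G) c) (v : G → ℝ) :
    (gram X G)⁻¹ *ᵥ (gram X G *ᵥ v) = v := by
  rw [mulVec_mulVec, nonsing_inv_mul _ (h.isUnit_det_gram hr hc), one_mulVec]

/-- Least squares coefficients in the model `G`, before extension by zero. -/
noncomputable def lsCoef (X : Matrix (Fin r) (Fin p) ℝ) (G : Finset (Fin p)) (w : Fin r → ℝ) : G → ℝ :=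
  (gram X G)⁻¹ *ᵥ ((cols X G)ᵀ *ᵥ w)

lemma ols_eq (X : Matrix (Fin r) (Fin p) ℝ) (Y : Fin r → ℝ) (G : Finset (Fin p)) :
    ols X Y G = extendZero (lsCoef X G Y) := rfl

lemma dotProduct_transpose_mulVec (X : Matrix (Fin r) (Fin p) ℝ) {G : Finset (Fin p)}
    (v : G → ℝ) (w : Fin r → ℝ) : v ⬝ᵥ ((cols X G)ᵀ *ᵥ w) = (cols X G *ᵥ v) ⬝ᵥ w := by
  rw [dotProduct_mulVec, vecMul_transpose]

lemma MinEigenvalueGE.fitted_dotProduct (hr : 0 < r) (hc : 0 < c)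
    (h : MinEigenvalueGE ((1 / (r : ℝ)) • gram X G) c) (v : G → ℝ) (w : Fin r → ℝ) :
    (cols X G *ᵥ v) ⬝ᵥ (cols X G *ᵥ lsCoef X G w) = (cols X G *ᵥ v) ⬝ᵥ w := by
  rw [← dotProduct_gram_mulVec, lsCoef, h.gram_mulVec_inv hr hc, dotProduct_transpose_mulVec]

/-- The fit `f` satisfies `‖f‖² = f ⬝ᵥ w`, so the hypothesis on `Z` forces `‖f‖² ≤ Z`. Taking for
`Z` the energy of `w` in the full column space is what later keeps the rank in the bound. -/
lemma MinEigenvalueGE.mul_sqNorm_lsCoef_le (hr : 0 < r) (hc : 0 < c)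
    (h : MinEigenvalueGE ((1 / (r : ℝ)) • gram X G) c) (w : Fin r → ℝ) {Z : ℝ}
    (hZ : ∀ b, ((X *ᵥ b) ⬝ᵥ w) ^ 2 ≤ sqNorm (X *ᵥ b) * Z) (hZ0 : 0 ≤ Z) :
    r * c * sqNorm (lsCoef X G w) ≤ Z := by
  refine (h.mul_sqNorm_le hr _).trans ?_
  have h1 := h.fitted_dotProduct hr hc (lsCoef X G w) w
  have h2 := hZ (extendZero (lsCoef X G w))
  rw [← cols_mulVec, ← h1, ← sqNorm_eq_dotProduct] at h2
  have h3 := sqNorm_nonneg (cols X G *ᵥ lsCoef X G w)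
  nlinarith

lemma MinEigenvalueGE.mul_sqNorm_lsCoef_le_sqNorm (hr : 0 < r) (hc : 0 < c)
    (h : MinEigenvalueGE ((1 / (r : ℝ)) • gram X G) c) (w : Fin r → ℝ) :
    r * c * sqNorm (lsCoef X G w) ≤ sqNorm w :=
  h.mul_sqNorm_lsCoef_le hr hc w (fun _ => dotProduct_sq_le _ _) (sqNorm_nonneg _)

/-- The weights with which the observations enter the least squares coefficient `j`. -/
noncomputable def lsWeight (X : Matrix (Fin r) (Fin p) ℝ) (G : Finset (Fin p)) (j : G) : Fin r → ℝ :=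
  ((gram X G)⁻¹ * (cols X G)ᵀ) j

lemma lsCoef_apply (X : Matrix (Fin r) (Fin p) ℝ) (G : Finset (Fin p)) (w : Fin r → ℝ) (j : G) :
    lsCoef X G w j = ∑ l, lsWeight X G j l * w l := by
  rw [lsCoef, mulVec_mulVec]
  rfl

/-- Feed the weight vector to least squares as a response: coefficient `j` is then its own squared
norm. -/
lemma MinEigenvalueGE.sqNorm_lsWeight_le (hr : 0 < r) (hc : 0 < c)
    (h : MinEigenvalueGE ((1 / (r : ℝ)) • gram X G) c) (j : G) :
    sqNorm (lsWeight X G j) ≤ 1 / (r * c) := by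
  have hrc : 0 < r * c := mul_pos (by exact_mod_cast hr) hc
  have h1 := h.mul_sqNorm_lsCoef_le_sqNorm hr hc (lsWeight X G j)
  have h2 := sq_le_sqNorm (lsCoef X G (lsWeight X G j)) j
  have h3 : lsCoef X G (lsWeight X G j) j = sqNorm (lsWeight X G j) := by
    rw [lsCoef_apply, sqNorm_eq_dotProduct]; rfl
  rw [h3] at h2
  rw [le_div_iff₀ hrc]
  by_contra! hcon
  have h4 : 0 < sqNorm (lsWeight X G j) := by
    rcases (sqNorm_nonneg (lsWeight X G j)).eq_or_lt with h | h
    · rw [← h] at hcon; linarith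
    · exact h
  nlinarith [mul_le_mul_of_nonneg_left h2 hrc.le]

lemma MinEigenvalueGE.sqNorm_inv_mulVec_le (hr : 0 < r) (hc : 0 < c)
    (h : MinEigenvalueGE ((1 / (r : ℝ)) • gram X G) c) (z : G → ℝ) :
    (r * c) ^ 2 * sqNorm ((gram X G)⁻¹ *ᵥ z) ≤ sqNorm z := by
  have hrc : 0 < r * c := mul_pos (by exact_mod_cast hr) hc
  set a := (gram X G)⁻¹ *ᵥ z with ha
  have h1 := h.mul_sqNorm_le hr a
  rw [sqNorm_eq_dotProduct (cols X G *ᵥ a), ← dotProduct_gram_mulVec, ha,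
    h.gram_mulVec_inv hr hc, ← ha] at h1
  have h2 := dotProduct_sq_le a z
  rcases (sqNorm_nonneg a).eq_or_lt with h0 | h0
  · rw [← h0, mul_zero]; exact sqNorm_nonneg z
  · have h3 : (r * c * sqNorm a) ^ 2 ≤ sqNorm a * sqNorm z :=
      (pow_le_pow_left₀ (by positivity) h1 2).trans h2
    nlinarith

/-- The frame is an orthonormal basis of the column space: the second bound is Bessel, the third is
Cauchy–Schwarz after projecting `w` onto that space. -/
lemma exists_orthonormal_frame (X : Matrix (Fin r) (Fin p) ℝ) :
    ∃ d : ℕ, d ≤ p ∧ ∃ u : Fin d → Fin r → ℝ, (∀ a, sqNorm (u a) = 1) ∧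
      (∀ w, ∑ a, (u a ⬝ᵥ w) ^ 2 ≤ sqNorm w) ∧
      ∀ b w, ((X *ᵥ b) ⬝ᵥ w) ^ 2 ≤ sqNorm (X *ᵥ b) * ∑ a, (u a ⬝ᵥ w) ^ 2 := by
  set f : Fin p → EuclideanSpace ℝ (Fin r) := fun j => WithLp.toLp 2 (fun l => X l j) with hf
  set U := Submodule.span ℝ (Set.range f) with hU
  set B := stdOrthonormalBasis ℝ U with hB
  have hinner : ∀ x y : EuclideanSpace ℝ (Fin r), inner ℝ x y = x.ofLp ⬝ᵥ y.ofLp := fun x y => by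
    simp [PiLp.inner_apply, dotProduct, mul_comm]
  have hon : Orthonormal ℝ (fun a => (B a : EuclideanSpace ℝ (Fin r))) :=
    B.orthonormal.comp_linearIsometry U.subtypeₗᵢ
  refine ⟨Module.finrank ℝ U, ?_, fun a => (B a : EuclideanSpace ℝ (Fin r)).ofLp, ?_, ?_, ?_⟩
  · exact (finrank_range_le_card (R := ℝ) f).trans (Fintype.card_fin p).le
  · intro a
    rw [sqNorm_eq_dotProduct, ← hinner, real_inner_self_eq_norm_sq, hon.1 a]
    norm_num
  · intro w
    have := hon.sum_inner_products_le (x := WithLp.toLp 2 w) (s := Finset.univ)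
    rw [← real_inner_self_eq_norm_sq, hinner, ← sqNorm_eq_dotProduct] at this
    refine le_trans (le_of_eq ?_) this
    refine Finset.sum_congr rfl fun a _ => ?_
    rw [hinner, Real.norm_eq_abs, sq_abs]
  · intro b w
    have hmem : WithLp.toLp 2 (X *ᵥ b) ∈ U := by
      have : WithLp.toLp 2 (X *ᵥ b) = ∑ j, b j • f j := by
        ext l
        simp [hf, mulVec, dotProduct, mul_comm]
      rw [this]
      exact Submodule.sum_mem _ fun j _ => Submodule.smul_mem _ _
        (Submodule.subset_span ⟨j, rfl⟩)
    set x : U := ⟨WithLp.toLp 2 (X *ᵥ b), hmem⟩ with hx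
    have hrep := congrArg (fun y : U => (y : EuclideanSpace ℝ (Fin r)).ofLp) (B.sum_repr x)
    have hnorm := B.sum_sq_norm_inner_right x
    have hxn : ‖x‖ ^ 2 = sqNorm (X *ᵥ b) := by
      rw [sqNorm_eq_dotProduct, ← real_inner_self_eq_norm_sq, Submodule.coe_inner, hinner]
    have hdot : (X *ᵥ b) ⬝ᵥ w =
        ∑ a, inner ℝ (B a) x * ((B a : EuclideanSpace ℝ (Fin r)).ofLp ⬝ᵥ w) := by
      have h1 : X *ᵥ b = ∑ a, inner ℝ (B a) x • (B a : EuclideanSpace ℝ (Fin r)).ofLp := by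
        have h2 : (x : EuclideanSpace ℝ (Fin r)).ofLp = X *ᵥ b := rfl
        rw [← h2, ← hrep]
        ext l
        simp [B.repr_apply_apply]
      conv_lhs => rw [h1]
      rw [sum_dotProduct]
      simp [smul_dotProduct]
    rw [hdot, ← hxn, ← hnorm]
    simp_rw [Real.norm_eq_abs, sq_abs]
    exact Finset.sum_mul_sq_le_sq_mul_sq _ _ _

end LeastSquares

/-! ### Support recovery by the Lasso -/

section Lasso

open Matrix

variable {r p : ℕ}

/-- The vector `u` is a subgradient of the penalty at `b₀`. Expanding the loss around `b₀`, the
excess loss of `b` is a quadratic term plus a sum of nonnegative penalty gaps; for a minimizer all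
vanish. Strictness off `S` kills those coordinates and injectivity on `S` does the rest. -/
lemma IsLasso.eq_of_certificate {X : Matrix (Fin r) (Fin p) ℝ} {Y : Fin r → ℝ} {lam : ℝ}
    {b b₀ u : Fin p → ℝ} {S : Finset (Fin p)} (hr : 0 < r) (hb : IsLasso lam X Y b)
    (hu : ∀ j, u j = 2 / r * (Xᵀ *ᵥ (Y - X *ᵥ b₀)) j)
    (hu_le : ∀ j, |u j| ≤ lam) (hu_lt : ∀ j ∉ S, |u j| < lam)
    (hub : ∀ j, u j * b₀ j = lam * |b₀ j|) (hb₀ : ∀ j ∉ S, b₀ j = 0)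
    (hinj : ∀ d : Fin p → ℝ, (∀ j ∉ S, d j = 0) → sqNorm (X *ᵥ d) = 0 → d = 0) :
    b = b₀ := by
  have hr' : (0 : ℝ) < r := by exact_mod_cast hr
  set R := Y - X *ᵥ b₀ with hR
  have h1 : Y - X *ᵥ b = R - X *ᵥ (b - b₀) := by rw [hR, mulVec_sub]; abel
  have h2 : sqNorm (Y - X *ᵥ b) =
      sqNorm R - 2 * ((Xᵀ *ᵥ R) ⬝ᵥ (b - b₀)) + sqNorm (X *ᵥ (b - b₀)) := by
    have h3 : (Xᵀ *ᵥ R) ⬝ᵥ (b - b₀) = R ⬝ᵥ (X *ᵥ (b - b₀)) := by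
      rw [dotProduct_mulVec, mulVec_transpose]
    rw [h1, h3]
    simp only [sqNorm_eq_dotProduct, sub_dotProduct, dotProduct_sub]
    rw [dotProduct_comm (X *ᵥ (b - b₀)) R]
    ring
  have h4 : 1 / (r : ℝ) * (2 * ((Xᵀ *ᵥ R) ⬝ᵥ (b - b₀))) =
      ∑ j, u j * b j - lam * ∑ j, |b₀ j| := by
    rw [Finset.mul_sum, ← Finset.sum_sub_distrib, dotProduct, Finset.mul_sum, Finset.mul_sum]
    refine Finset.sum_congr rfl fun j _ => ?_
    rw [← hub j, hu j, Pi.sub_apply]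
    ring
  have h5 := hb b₀
  rw [lassoLoss, lassoLoss, h2, ← hR] at h5
  have h6 : 1 / (r : ℝ) * sqNorm (X *ᵥ (b - b₀)) + ∑ j, (lam * |b j| - u j * b j) ≤ 0 := by
    rw [Finset.sum_sub_distrib, ← Finset.mul_sum]
    linarith
  have hterm : ∀ j, (lam - |u j|) * |b j| ≤ lam * |b j| - u j * b j := fun j => by
    have := (le_abs_self (u j * b j))
    rw [abs_mul] at this
    linarith
  have hterm0 : ∀ j, 0 ≤ lam * |b j| - u j * b j := fun j =>
    (mul_nonneg (sub_nonneg.2 (hu_le j)) (abs_nonneg _)).trans (hterm j)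
  have hX0 : 0 ≤ 1 / (r : ℝ) * sqNorm (X *ᵥ (b - b₀)) :=
    mul_nonneg (by positivity) (sqNorm_nonneg _)
  have hsum0 : 0 ≤ ∑ j, (lam * |b j| - u j * b j) := Finset.sum_nonneg fun j _ => hterm0 j
  have hsz : ∑ j, (lam * |b j| - u j * b j) = 0 := by linarith
  have hXz : sqNorm (X *ᵥ (b - b₀)) = 0 := by
    have : 1 / (r : ℝ) * sqNorm (X *ᵥ (b - b₀)) = 0 := by linarith
    rcases mul_eq_zero.1 this with h | h
    · exact absurd h (by positivity)
    · exact h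
  have hoff : ∀ j ∉ S, b j = 0 := fun j hj => by
    have h7 := (Finset.sum_eq_zero_iff_of_nonneg fun j _ => hterm0 j).1 hsz j (Finset.mem_univ j)
    have h8 := hterm j
    rw [h7] at h8
    have h9 := sub_pos.2 (hu_lt j hj)
    by_contra hne
    exact absurd h8 (not_le.2 (mul_pos h9 (abs_pos.2 hne)))
  exact sub_eq_zero.1 (hinj (b - b₀) (fun j hj => by simp [hoff j hj, hb₀ j hj]) hXz)

lemma sign_mul_add_eq_abs {x y : ℝ} (h : |y| < |x|) :
    x + y ≠ 0 ∧ Real.sign x * (x + y) = |x + y| := by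
  rcases lt_trichotomy x 0 with hx | rfl | hx
  · rw [abs_of_neg hx] at h
    have h1 : x + y < 0 := by linarith [le_abs_self y]
    exact ⟨h1.ne, by rw [Real.sign_of_neg hx, abs_of_neg h1]; ring⟩
  · simp at h
    exact absurd h (not_lt.2 (abs_nonneg y))
  · rw [abs_of_pos hx] at h
    have h1 : 0 < x + y := by linarith [neg_abs_le y]
    exact ⟨h1.ne', by rw [Real.sign_of_pos hx, abs_of_pos h1]; ring⟩

/-- Column `j` of the design, after projecting out the columns of the model `G`. -/
noncomputable def residCol (X : Matrix (Fin r) (Fin p) ℝ) (G : Finset (Fin p)) (j : Fin p) :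
    Fin r → ℝ :=
  (fun l => X l j) - cols X G *ᵥ lsCoef X G (fun l => X l j)

lemma MinEigenvalueGE.sqNorm_residCol_le {X : Matrix (Fin r) (Fin p) ℝ} {G : Finset (Fin p)}
    {c : ℝ} (hr : 0 < r) (hc : 0 < c) (h : MinEigenvalueGE ((1 / (r : ℝ)) • gram X G) c)
    (j : Fin p) : sqNorm (residCol X G j) ≤ ∑ l, X l j ^ 2 := by
  set x : Fin r → ℝ := fun l => X l j with hx
  have h1 := h.fitted_dotProduct hr hc (lsCoef X G x) x
  have h2 : sqNorm (residCol X G j) = sqNorm x - sqNorm (cols X G *ᵥ lsCoef X G x) := by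
    simp only [residCol, ← hx, sqNorm_eq_dotProduct, sub_dotProduct, dotProduct_sub]
    rw [dotProduct_comm x (cols X G *ᵥ lsCoef X G x), h1]
    ring
  have h3 := sqNorm_nonneg (cols X G *ᵥ lsCoef X G x)
  have h4 : sqNorm x = ∑ l, X l j ^ 2 := rfl
  linarith

/-- Every Lasso estimate has the support of `β`, provided the noise `w` is small in the relevant
directions. -/
lemma IsLasso.supp_eq {X : Matrix (Fin r) (Fin p) ℝ} {β b : Fin p → ℝ} {w : Fin r → ℝ}
    {lam V₂ η : ℝ} (hr : 0 < r) (hV : 0 < V₂) (hlam : 0 < lam)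
    (heig : MinEigenvalueGE ((1 / (r : ℝ)) • gram X (supp β)) V₂) (hirr : CondA3 η X β)
    (hon : ∀ j : supp β, |∑ l, lsWeight X (supp β) j l * w l| +
      lam * Real.sqrt (supp β).card / (2 * V₂) < |β j|)
    (hoff : ∀ j ∉ supp β, |∑ l, residCol X (supp β) j l * w l| < η * lam * r / 2)
    (hb : IsLasso lam X (X *ᵥ β + w) b) : supp b = supp β := by
  have hr' : (0 : ℝ) < r := by exact_mod_cast hr
  set S := supp β with hS
  set A := cols X S with hA
  set sgn : S → ℝ := fun a => Real.sign (β a) with hsgn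
  set βS : S → ℝ := fun a => β a with hβS
  set q : S → ℝ := (gram X S)⁻¹ *ᵥ sgn with hq
  -- The solution of the stationarity equations on `S` with the signs of `β` prescribed: least
  -- squares error minus Lasso shrinkage.
  set d : S → ℝ := lsCoef X S w - (r * lam / 2) • q with hd
  have hext : extendZero βS = β := by
    ext j
    by_cases hj : j ∈ S
    · simp [extendZero, hj, hβS]
    · have : β j = 0 := by simpa [hS, supp] using hj
      simp [extendZero, hj, this]
  have hXβ : X *ᵥ β = A *ᵥ βS := by rw [hA, cols_mulVec, hext]
  set b₀ : Fin p → ℝ := extendZero (βS + d) with hb₀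
  have hb₀S : ∀ j : S, b₀ j = β j + d j := fun j => by simp [hb₀, extendZero, hβS]
  have hb₀c : ∀ j ∉ S, b₀ j = 0 := fun j hj => by simp [hb₀, extendZero, hj]
  have hres : X *ᵥ β + w - X *ᵥ b₀ = w - A *ᵥ lsCoef X S w + (r * lam / 2) • (A *ᵥ q) := by
    rw [hb₀, ← cols_mulVec, ← hA, hXβ, mulVec_add, hd, mulVec_sub, mulVec_smul]
    abel
  have hqle : ∀ j, |q j| ≤ Real.sqrt S.card / (r * V₂) := by
    intro j
    have h1 := heig.sqNorm_inv_mulVec_le hr hV sgn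
    have h2 : sqNorm sgn = S.card := by
      have : ∀ j : S, sgn j ^ 2 = 1 := fun j => by
        have hj : β j ≠ 0 := by simpa [hS, supp] using j.2
        rcases Real.sign_apply_eq_of_ne_zero _ hj with h | h <;> simp [hsgn, h]
      simp [sqNorm, this]
    have h3 := sq_le_sqNorm q j
    have hrV : 0 < r * V₂ := mul_pos hr' hV
    rw [le_div_iff₀ hrV]
    refine Real.le_sqrt_of_sq_le ?_
    rw [mul_pow, sq_abs, ← h2]
    nlinarith [sq_nonneg (r * V₂)]
  -- The perturbation is too small to flip a sign, so the prescribed signs are those of `b₀`.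
  have hdlt : ∀ j : S, |d j| < |β j| := by
    intro j
    refine lt_of_le_of_lt ?_ (hon j)
    rw [hd, Pi.sub_apply, lsCoef_apply, Pi.smul_apply, smul_eq_mul]
    refine (abs_sub _ _).trans ?_
    gcongr
    rw [abs_mul, abs_of_pos (by positivity)]
    calc r * lam / 2 * |q j| ≤ r * lam / 2 * (Real.sqrt S.card / (r * V₂)) := by
          gcongr
          exact hqle j
      _ = _ := by field_simp
  set u : Fin p → ℝ := fun j => 2 / r * (Xᵀ *ᵥ (X *ᵥ β + w - X *ᵥ b₀)) j with hu
  have huS : ∀ j : S, u j = lam * sgn j := by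
    intro j
    have h1 : (Xᵀ *ᵥ (X *ᵥ β + w - X *ᵥ b₀)) j = (Aᵀ *ᵥ (X *ᵥ β + w - X *ᵥ b₀)) j := rfl
    have h2 : Aᵀ *ᵥ (X *ᵥ β + w - X *ᵥ b₀) = (r * lam / 2) • sgn := by
      have h3 : ∀ v, Aᵀ *ᵥ (A *ᵥ v) = gram X S *ᵥ v := fun v => by
        rw [mulVec_mulVec, gram, hA]
      rw [hres, mulVec_add, mulVec_sub, mulVec_smul, h3, h3, lsCoef,
        heig.gram_mulVec_inv hr hV, hq, heig.gram_mulVec_inv hr hV, ← hA, sub_self, zero_add]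
    simp only [hu]
    rw [h1, h2, Pi.smul_apply, smul_eq_mul]
    field_simp
  have huc : ∀ j ∉ S, |u j| < lam := by
    intro j hj
    set x : Fin r → ℝ := fun l => X l j with hx
    have h1 : (Xᵀ *ᵥ (X *ᵥ β + w - X *ᵥ b₀)) j = x ⬝ᵥ (X *ᵥ β + w - X *ᵥ b₀) := rfl
    have hj' : j ∈ Sᶜ := Finset.mem_compl.2 hj
    have h2 : ((cols X Sᶜ).transpose * cols X S * (gram X S)⁻¹).mulVec sgn ⟨j, hj'⟩ =
        x ⬝ᵥ (A *ᵥ q) := by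
      rw [← mulVec_mulVec, ← mulVec_mulVec]
      rfl
    have h3 : |((cols X Sᶜ).transpose * cols X S * (gram X S)⁻¹).mulVec sgn ⟨j, hj'⟩| < 1 - η :=
      hirr ⟨j, hj'⟩
    rw [h2] at h3
    have h4 : x ⬝ᵥ (w - A *ᵥ lsCoef X S w) = residCol X S j ⬝ᵥ w := by
      have e1 := heig.fitted_dotProduct hr hV (lsCoef X S x) w
      have e2 := heig.fitted_dotProduct hr hV (lsCoef X S w) x
      rw [residCol, ← hx, dotProduct_sub, sub_dotProduct, ← hA, dotProduct_comm x (A *ᵥ _), ← e2,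
        ← e1, dotProduct_comm (cols X S *ᵥ lsCoef X S w)]
    simp only [hu]
    rw [h1, hres, dotProduct_add, h4, dotProduct_smul, smul_eq_mul]
    have h5 := hoff j hj
    have h6 : residCol X S j ⬝ᵥ w = ∑ l, residCol X S j l * w l := rfl
    rw [← h6] at h5
    -- The irrepresentable condition leaves a margin `η * lam`, and the noise uses less than that.
    calc |2 / r * (residCol X S j ⬝ᵥ w + r * lam / 2 * (x ⬝ᵥ (A *ᵥ q)))|
        = |2 / r * (residCol X S j ⬝ᵥ w) + lam * (x ⬝ᵥ (A *ᵥ q))| := by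
          congr 1; field_simp
      _ ≤ 2 / r * |residCol X S j ⬝ᵥ w| + lam * |x ⬝ᵥ (A *ᵥ q)| := by
          refine (abs_add_le _ _).trans (le_of_eq ?_)
          rw [abs_mul, abs_mul, abs_of_pos hlam, abs_of_pos (by positivity : (0 : ℝ) < 2 / r)]
      _ < 2 / r * (η * lam * r / 2) + lam * (1 - η) := by gcongr
      _ = lam := by field_simp; ring
  have hbb : b = b₀ := by
    refine hb.eq_of_certificate (S := S) (u := u) hr (fun j => rfl) ?_ huc ?_ hb₀c ?_
    · intro j
      by_cases hj : j ∈ S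
      · rw [huS ⟨j, hj⟩, abs_mul, abs_of_pos hlam]
        have hj0 : β j ≠ 0 := by simpa [hS, supp] using hj
        rcases Real.sign_apply_eq_of_ne_zero _ hj0 with h | h <;> simp [hsgn, h]
      · exact (huc j hj).le
    · intro j
      by_cases hj : j ∈ S
      · rw [huS ⟨j, hj⟩, hb₀S ⟨j, hj⟩, mul_assoc, (sign_mul_add_eq_abs (hdlt ⟨j, hj⟩)).2]
      · rw [hb₀c j hj]; simp
    · intro v hv hz
      set vS : S → ℝ := fun a => v a with hvS
      have hvext : extendZero vS = v := by
        ext j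
        by_cases hj : j ∈ S
        · simp [extendZero, hj, hvS]
        · simp [extendZero, hj, hv j hj]
      have h1 := heig.mul_sqNorm_le hr vS
      rw [cols_mulVec, hvext, hz] at h1
      have h2 : sqNorm vS = 0 := by
        have := sqNorm_nonneg vS
        have := mul_pos hr' hV
        nlinarith
      rw [← hvext, sqNorm_eq_zero h2]
      ext j
      simp [extendZero]
  ext j
  by_cases hj : j ∈ S
  · have h1 := (sign_mul_add_eq_abs (hdlt ⟨j, hj⟩)).1
    rw [← hb₀S ⟨j, hj⟩] at h1
    simp [hj, supp, hbb, h1]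
  · simp [hj, supp, hbb, hb₀c j hj]

end Lasso

/-! ### Loss of the aggregated estimator -/

section Aggregated

open Matrix

variable {r p m n : ℕ}

lemma sqNorm_extendZero {G : Finset (Fin p)} (v : G → ℝ) : sqNorm (extendZero v) = sqNorm v := by
  rw [sqNorm, sqNorm, ← Finset.sum_subset (Finset.subset_univ G), ← Finset.sum_coe_sort G]
  · refine Finset.sum_congr rfl fun j _ => ?_
    simp [extendZero]
  · intro j _ hj
    simp [extendZero, hj]

lemma sqNorm_mulVec_le {X : Matrix (Fin r) (Fin p) ℝ} {V₁ : ℝ} (hr : 0 < r)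
    (hcol : ∀ j, (1 / (r : ℝ)) * ∑ l, (X l j) ^ 2 ≤ V₁) {S : Finset (Fin p)} {v : Fin p → ℝ}
    (hv : ∀ j ∉ S, v j = 0) : sqNorm (X *ᵥ v) ≤ S.card * r * V₁ * sqNorm v := by
  have hr' : (0 : ℝ) < r := by exact_mod_cast hr
  have hcol' : ∀ j, ∑ l, (X l j) ^ 2 ≤ r * V₁ := fun j => by
    have := hcol j
    rw [one_div, inv_mul_eq_div, div_le_iff₀ hr'] at this
    linarith
  have h1 : ∀ l, (X *ᵥ v) l = ∑ j ∈ S, X l j * v j := fun l =>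
    (Finset.sum_subset (Finset.subset_univ S) fun j _ hj => by simp [hv j hj]).symm
  calc sqNorm (X *ᵥ v) = ∑ l, (∑ j ∈ S, X l j * v j) ^ 2 := by simp only [sqNorm, h1]
    _ ≤ ∑ l, S.card * ∑ j ∈ S, (X l j * v j) ^ 2 :=
        Finset.sum_le_sum fun l _ => sq_sum_le_card_mul_sum_sq
    _ = S.card * ∑ j ∈ S, (∑ l, X l j ^ 2) * v j ^ 2 := by
        rw [← Finset.mul_sum, Finset.sum_comm]
        simp only [mul_pow, Finset.sum_mul]
    _ ≤ S.card * ∑ j ∈ S, (r * V₁) * v j ^ 2 := by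
        gcongr with j
        exact hcol' j
    _ = S.card * r * V₁ * ∑ j ∈ S, v j ^ 2 := by rw [← Finset.mul_sum]; ring
    _ = S.card * r * V₁ * sqNorm v := by
        rw [sqNorm, Finset.sum_subset (Finset.subset_univ S) fun j _ hj => by simp [hv j hj]]

lemma MinEigenvalueGE.lsCoef_mulVec_add {X : Matrix (Fin r) (Fin p) ℝ} {G : Finset (Fin p)}
    {c : ℝ} (hr : 0 < r) (hc : 0 < c) (h : MinEigenvalueGE ((1 / (r : ℝ)) • gram X G) c)
    (v : G → ℝ) (w : Fin r → ℝ) : lsCoef X G (cols X G *ᵥ v + w) = v + lsCoef X G w := by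
  have h1 : (cols X G)ᵀ *ᵥ (cols X G *ᵥ v) = gram X G *ᵥ v := by rw [mulVec_mulVec, gram]
  rw [lsCoef, mulVec_add, mulVec_add, h1, h.inv_mulVec_gram hr hc, lsCoef]

/-- The model `G` may depend on the noise, so the noise term must not involve `G`. Signal inside `G`
is reproduced exactly, the omitted part `β'` acts as additional noise, and the energy in the span of
`G` is replaced by that in the whole column space. -/
lemma MinEigenvalueGE.sqNorm_ols_sub_le {X : Matrix (Fin r) (Fin p) ℝ} {G : Finset (Fin p)}
    {c V₁ : ℝ} {β : Fin p → ℝ} (hr : 0 < r) (hc : 0 < c)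
    (h : MinEigenvalueGE ((1 / (r : ℝ)) • gram X G) c)
    (hcol : ∀ j, (1 / (r : ℝ)) * ∑ l, (X l j) ^ 2 ≤ V₁) (hV₁ : 0 ≤ V₁) (w : Fin r → ℝ)
    {d : ℕ} {u : Fin d → Fin r → ℝ} (hu : ∀ w, ∑ a, (u a ⬝ᵥ w) ^ 2 ≤ sqNorm w)
    (huX : ∀ b w, ((X *ᵥ b) ⬝ᵥ w) ^ 2 ≤ sqNorm (X *ᵥ b) * ∑ a, (u a ⬝ᵥ w) ^ 2) :
    sqNorm (ols X (X *ᵥ β + w) G - β) ≤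
      (1 + 2 * c⁻¹ * (supp β).card * V₁) * sqNorm β +
        2 * c⁻¹ * ((∑ a, (u a ⬝ᵥ w) ^ 2) / r) := by
  have hr' : (0 : ℝ) < r := by exact_mod_cast hr
  set βG : G → ℝ := fun j => β j with hβG
  set β' : Fin p → ℝ := fun j => if j ∈ G then 0 else β j with hβ'
  have hX : X *ᵥ β + w = cols X G *ᵥ βG + (X *ᵥ β' + w) := by
    have hβ : extendZero βG + β' = β := by
      ext j
      by_cases hj : j ∈ G <;> simp [extendZero, hβG, hβ', hj]
    rw [← hβ, mulVec_add, cols_mulVec, add_assoc]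
  set v := lsCoef X G (X *ᵥ β' + w) with hv
  have hβ'le : sqNorm β' ≤ sqNorm β := Finset.sum_le_sum fun j _ => by
    by_cases hj : j ∈ G <;> simp [hβ', hj, sq_nonneg]
  have hsplit : sqNorm (ols X (X *ᵥ β + w) G - β) = sqNorm v + sqNorm β' := by
    rw [ols_eq, hX, h.lsCoef_mulVec_add hr hc, ← hv, ← sqNorm_extendZero v, sqNorm, sqNorm, sqNorm,
      ← Finset.sum_add_distrib]
    refine Finset.sum_congr rfl fun j _ => ?_
    by_cases hj : j ∈ G <;> simp [extendZero, hβG, hβ', hj]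
  have hZ : ∑ a, (u a ⬝ᵥ (X *ᵥ β' + w)) ^ 2 ≤
      2 * ((supp β).card * r * V₁ * sqNorm β) + 2 * ∑ a, (u a ⬝ᵥ w) ^ 2 := by
    have h1 : sqNorm (X *ᵥ β') ≤ (supp β).card * r * V₁ * sqNorm β := by
      refine (sqNorm_mulVec_le hr hcol (S := supp β) fun j hj => ?_).trans ?_
      · have : β j = 0 := by simpa [supp] using hj
        simp [hβ', this]
      · gcongr
    calc ∑ a, (u a ⬝ᵥ (X *ᵥ β' + w)) ^ 2
        ≤ ∑ a, (2 * (u a ⬝ᵥ (X *ᵥ β')) ^ 2 + 2 * (u a ⬝ᵥ w) ^ 2) :=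
          Finset.sum_le_sum fun a _ => by
            rw [dotProduct_add]
            nlinarith [sq_nonneg (u a ⬝ᵥ (X *ᵥ β') - u a ⬝ᵥ w)]
      _ = 2 * ∑ a, (u a ⬝ᵥ (X *ᵥ β')) ^ 2 + 2 * ∑ a, (u a ⬝ᵥ w) ^ 2 := by
          rw [Finset.sum_add_distrib, Finset.mul_sum, Finset.mul_sum]
      _ ≤ _ := by
          have := (hu (X *ᵥ β')).trans h1
          linarith
  have hls := h.mul_sqNorm_lsCoef_le hr hc (X *ᵥ β' + w) (fun b => huX b _)
    (Finset.sum_nonneg fun a _ => sq_nonneg _)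
  rw [← hv] at hls
  have hv_le : sqNorm v ≤ 2 * c⁻¹ * (supp β).card * V₁ * sqNorm β +
      2 * c⁻¹ * ((∑ a, (u a ⬝ᵥ w) ^ 2) / r) := by
    have h2 : sqNorm v ≤ (2 * ((supp β).card * r * V₁ * sqNorm β) +
        2 * ∑ a, (u a ⬝ᵥ w) ^ 2) / (r * c) := by
      rw [le_div_iff₀ (by positivity)]
      linarith
    refine h2.trans (le_of_eq ?_)
    field_simp
  rw [hsplit]
  linarith

lemma sqNorm_aggregated_sub_le (hm : 0 < m) (e : Fin n ≃ Fin m × Fin r)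
    (X : Matrix (Fin n) (Fin p) ℝ) (Y : Fin n → ℝ) (G : Finset (Fin p)) (β : Fin p → ℝ) :
    sqNorm (aggregated e X Y G - β) ≤
      (∑ i, sqNorm (ols (subX e X i) (subY e Y i) G - β)) / m := by
  have hm' : (0 : ℝ) < m := by exact_mod_cast hm
  simp only [sqNorm]
  rw [Finset.sum_comm, Finset.sum_div]
  refine Finset.sum_le_sum fun j _ => ?_
  have h1 : (aggregated e X Y G - β) j =
      (∑ i, (ols (subX e X i) (subY e Y i) G - β) j) / m := by
    simp only [aggregated, Pi.sub_apply, Finset.sum_sub_distrib, Finset.sum_const,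
      Finset.card_univ, Fintype.card_fin, nsmul_eq_mul]
    field_simp
  rw [h1, div_pow, pow_two (m : ℝ), ← div_div]
  gcongr
  rw [div_le_iff₀ hm', mul_comm]
  have := sq_sum_le_card_mul_sum_sq (s := Finset.univ)
    (f := fun i => (ols (subX e X i) (subY e Y i) G - β) j)
  simpa using this

/-- The weight of observation `x` in coefficient `j` of the aggregated estimator. -/
noncomputable def aggWeight (e : Fin n ≃ Fin m × Fin r) (X : Matrix (Fin n) (Fin p) ℝ)
    (G : Finset (Fin p)) (j : G) : Fin n → ℝ :=
  fun x => lsWeight (subX e X (e x).1) G j (e x).2 / m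

lemma sum_ols_div (e : Fin n ≃ Fin m × Fin r) (X : Matrix (Fin n) (Fin p) ℝ)
    (G : Finset (Fin p)) (j : G) (y : Fin n → ℝ) :
    (∑ i, lsCoef (subX e X i) G (subY e y i) j) / m = ∑ x, aggWeight e X G j x * y x := by
  rw [← e.symm.sum_comp, Fintype.sum_prod_type, Finset.sum_div]
  refine Finset.sum_congr rfl fun i _ => ?_
  rw [lsCoef_apply, Finset.sum_div]
  refine Finset.sum_congr rfl fun l _ => ?_
  simp only [aggWeight, Equiv.apply_symm_apply, subY]
  ring

lemma aggregated_eq (e : Fin n ≃ Fin m × Fin r) (X : Matrix (Fin n) (Fin p) ℝ)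
    (G : Finset (Fin p)) (y : Fin n → ℝ) :
    aggregated e X y G = extendZero fun j => ∑ x, aggWeight e X G j x * y x := by
  ext j
  by_cases hj : j ∈ G
  · simp only [aggregated, extendZero, ols_eq, hj, dif_pos, ← sum_ols_div]
  · simp [aggregated, extendZero, ols_eq, hj]

lemma sqNorm_aggWeight_le {V₂ : ℝ} (hm : 0 < m) (hr : 0 < r) (hV : 0 < V₂)
    (e : Fin n ≃ Fin m × Fin r) (X : Matrix (Fin n) (Fin p) ℝ) {G : Finset (Fin p)}
    (h : ∀ i, MinEigenvalueGE ((1 / (r : ℝ)) • gram (subX e X i) G) V₂) (j : G) :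
    sqNorm (aggWeight e X G j) ≤ V₂⁻¹ / (m * r) := by
  have hm' : (0 : ℝ) < m := by exact_mod_cast hm
  have hr' : (0 : ℝ) < r := by exact_mod_cast hr
  rw [sqNorm, ← e.symm.sum_comp, Fintype.sum_prod_type]
  calc ∑ i, ∑ l, aggWeight e X G j (e.symm (i, l)) ^ 2
      = ∑ i, sqNorm (lsWeight (subX e X i) G j) / m ^ 2 := by
        refine Finset.sum_congr rfl fun i _ => ?_
        rw [sqNorm, Finset.sum_div]
        refine Finset.sum_congr rfl fun l _ => ?_
        simp [aggWeight, div_pow]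
    _ ≤ ∑ i : Fin m, 1 / (r * V₂) / m ^ 2 := by
        gcongr with i
        exact (h i).sqNorm_lsWeight_le hr hV j
    _ = _ := by
        simp
        field_simp

lemma aggregated_supp_sub {V₂ : ℝ} (hm : 0 < m) (hr : 0 < r) (hV : 0 < V₂)
    (e : Fin n ≃ Fin m × Fin r) (X : Matrix (Fin n) (Fin p) ℝ) {β : Fin p → ℝ}
    (h : ∀ i, MinEigenvalueGE ((1 / (r : ℝ)) • gram (subX e X i) (supp β)) V₂) (w : Fin n → ℝ) :
    sqNorm (aggregated e X (X *ᵥ β + w) (supp β) - β) =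
      ∑ j, (∑ x, aggWeight e X (supp β) j x * w x) ^ 2 := by
  have hm' : (0 : ℝ) < m := by exact_mod_cast hm
  set S := supp β with hS
  set βS : S → ℝ := fun a => β a with hβS
  have hext : extendZero βS = β := by
    ext j
    by_cases hj : j ∈ S
    · simp [extendZero, hj, hβS]
    · have : β j = 0 := by simpa [hS, supp] using hj
      simp [extendZero, hj, this]
  have h1 : aggregated e X (X *ᵥ β + w) S - β =
      extendZero fun j => ∑ x, aggWeight e X S j x * w x := by
    ext j
    by_cases hj : j ∈ S
    · have h2 : ∀ i, lsCoef (subX e X i) S (subY e (X *ᵥ β + w) i) =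
          βS + lsCoef (subX e X i) S (subY e w i) := fun i => by
        rw [← (h i).lsCoef_mulVec_add hr hV, cols_mulVec, hext]
        rfl
      simp only [Pi.sub_apply, aggregated, ols_eq, h2]
      simp only [extendZero, hj, dif_pos, Pi.add_apply, Finset.sum_add_distrib, ← sum_ols_div,
        hβS, Finset.sum_const, Finset.card_univ, Fintype.card_fin, nsmul_eq_mul]
      field_simp
      ring
    · have : β j = 0 := by simpa [hS, supp] using hj
      simp [aggregated, ols_eq, extendZero, hj, this]
  rw [h1, sqNorm_extendZero, sqNorm]

end Aggregated

/-! ### A single block -/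

section Block

open Matrix

variable {Ω : Type*} [MeasurableSpace Ω] {μ : Measure Ω} {k σ M : ℝ} {r p : ℕ}

/-- The direction in which the noise matters for coordinate `j`. -/
noncomputable def noiseDir (X : Matrix (Fin r) (Fin p) ℝ) (S : Finset (Fin p)) (j : Fin p) :
    Fin r → ℝ :=
  if h : j ∈ S then lsWeight X S ⟨j, h⟩ else residCol X S j

/-- The noise vectors that are large in one of the relevant directions. -/
def failSet (X : Matrix (Fin r) (Fin p) ℝ) (S : Finset (Fin p)) (t₁ t₂ : ℝ) : Set (Fin r → ℝ) :=
  {w | ∃ j, (if j ∈ S then t₁ else t₂) ≤ |∑ l, noiseDir X S j l * w l|}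

lemma measurableSet_failSet (X : Matrix (Fin r) (Fin p) ℝ) (S : Finset (Fin p)) (t₁ t₂ : ℝ) :
    MeasurableSet (failSet X S t₁ t₂) := by
  have : failSet X S t₁ t₂ =
      ⋃ j, {w | (if j ∈ S then t₁ else t₂) ≤ |∑ l, noiseDir X S j l * w l|} := by
    ext w; simp [failSet]
  rw [this]
  refine MeasurableSet.iUnion fun j => measurableSet_le measurable_const ?_
  fun_prop

lemma IsLasso.supp_eq_of_notMem_failSet {X : Matrix (Fin r) (Fin p) ℝ} {β b : Fin p → ℝ}
    {w : Fin r → ℝ} {lam V₂ η t₁ : ℝ} (hr : 0 < r) (hV : 0 < V₂) (hlam : 0 < lam)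
    (heig : MinEigenvalueGE ((1 / (r : ℝ)) • gram X (supp β)) V₂) (hirr : CondA3 η X β)
    (hsig : ∀ j ∈ supp β, t₁ + lam * Real.sqrt (supp β).card / (2 * V₂) ≤ |β j|)
    (hw : w ∉ failSet X (supp β) t₁ (η * lam * r / 2))
    (hb : IsLasso lam X (X *ᵥ β + w) b) : supp b = supp β := by
  have hw' : ∀ j, |∑ l, noiseDir X (supp β) j l * w l| <
      if j ∈ supp β then t₁ else η * lam * r / 2 := by
    simpa [failSet] using hw
  refine hb.supp_eq hr hV hlam heig hirr (fun j => ?_) (fun j hj => ?_)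
  · have h1 := hw' j
    have h2 := hsig j j.2
    rw [if_pos j.2] at h1
    simp only [noiseDir, j.2, dif_pos] at h1
    linarith
  · have h1 := hw' j
    rw [if_neg hj] at h1
    simpa only [noiseDir, hj, dif_neg, not_false_eq_true] using h1

/-- Union bound over coordinates; `D` is a common bound for the ratio of squared norm to squared
threshold, on and off the support. -/
lemma measureReal_failSet_le [IsProbabilityMeasure μ] {ε : Fin r → Ω → ℝ} {K D t₁ t₂ : ℝ}
    (hk : 0 < k) (hK : 0 < K)
    (htail : ∀ (a : Fin r → ℝ) (t : ℝ), 0 < t →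
      μ.real {ω | t ≤ |∑ l, a l * ε l ω|} ≤ K * (sqNorm a / t ^ 2) ^ k)
    (X : Matrix (Fin r) (Fin p) ℝ) (S : Finset (Fin p)) (ht₁ : 0 < t₁) (ht₂ : 0 < t₂)
    (h₁ : ∀ j : S, sqNorm (lsWeight X S j) ≤ D * t₁ ^ 2)
    (h₂ : ∀ j ∉ S, sqNorm (residCol X S j) ≤ D * t₂ ^ 2) :
    μ.real ((fun ω l => ε l ω) ⁻¹' failSet X S t₁ t₂) ≤ p * (K * D ^ k) := by
  have hset : (fun ω l => ε l ω) ⁻¹' failSet X S t₁ t₂ =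
      ⋃ j, {ω | (if j ∈ S then t₁ else t₂) ≤ |∑ l, noiseDir X S j l * ε l ω|} := by
    ext ω; simp [failSet]
  rw [hset]
  refine (measureReal_iUnion_fintype_le _).trans ?_
  calc ∑ j, μ.real {ω | (if j ∈ S then t₁ else t₂) ≤ |∑ l, noiseDir X S j l * ε l ω|}
      ≤ ∑ j : Fin p, K * D ^ k := by
        refine Finset.sum_le_sum fun j _ => ?_
        have ht : 0 < if j ∈ S then t₁ else t₂ := by split_ifs <;> assumption
        refine (htail _ _ ht).trans ?_
        have hle : sqNorm (noiseDir X S j) ≤ D * (if j ∈ S then t₁ else t₂) ^ 2 := by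
          by_cases hj : j ∈ S
          · simpa only [noiseDir, hj, dif_pos, if_true] using h₁ ⟨j, hj⟩
          · simpa only [noiseDir, hj, dif_neg, not_false_eq_true, if_false] using h₂ j hj
        gcongr
        · exact div_nonneg (sqNorm_nonneg _) (by positivity)
        · rw [div_le_iff₀ (by positivity)]
          exact hle
    _ = _ := by simp

/-- Uniform integrability of the squared errors when `k > 1`. -/
lemma exists_truncation (k σ M : ℝ) (hσ : σ ≠ 0) (hk : 1 < k) :
    ∃ Q : ℝ, 0 < Q ∧ ∀ {Ω : Type*} [MeasurableSpace Ω] (μ : Measure Ω) [IsProbabilityMeasure μ]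
      {n : ℕ} (ε : Fin n → Ω → ℝ), ErrorModel μ k σ M ε → ∀ F : Set Ω, MeasurableSet F →
      μ.real F ≤ Q → ∀ l, ∫ ω in F, ε l ω ^ 2 ∂μ ≤ σ ^ 2 / 64 := by
  have hσ2 : 0 < σ ^ 2 := by positivity
  -- Truncation level for `ε²`: the part above `L` contributes at most `σ² / 128` by the moment
  -- bound, and the part below at most `L * μ.real F`, again at most `σ² / 128`.
  set L : ℝ := (128 * (|M| + 1) / σ ^ 2) ^ (k - 1)⁻¹ with hL
  have hL0 : 0 < L := by positivity
  have hLk : L ^ (k - 1) = 128 * (|M| + 1) / σ ^ 2 := by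
    rw [hL, ← Real.rpow_mul (by positivity), inv_mul_cancel₀ (by linarith), Real.rpow_one]
  refine ⟨σ ^ 2 / (128 * L), by positivity, fun {Ω} _ μ _ {n} ε h F hF hQ l => ?_⟩
  have hpt : ∀ ω, ε l ω ^ 2 ≤ L + (L ^ (k - 1))⁻¹ * |ε l ω| ^ (2 * k) := by
    intro ω
    have hp : 0 ≤ (L ^ (k - 1))⁻¹ * |ε l ω| ^ (2 * k) := by positivity
    rcases le_total (ε l ω ^ 2) L with h1 | h1
    · linarith
    · have hpos : 0 < ε l ω ^ 2 := hL0.trans_le h1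
      have h2 : |ε l ω| ^ (2 * k) = (ε l ω ^ 2) ^ (k - 1) * ε l ω ^ 2 := by
        rw [← Real.rpow_add_one hpos.ne', sub_add_cancel, Real.rpow_mul (abs_nonneg _)]
        norm_num
      have h3 : L ^ (k - 1) ≤ (ε l ω ^ 2) ^ (k - 1) :=
        Real.rpow_le_rpow hL0.le h1 (by linarith)
      have h4 : ε l ω ^ 2 ≤ (L ^ (k - 1))⁻¹ * |ε l ω| ^ (2 * k) := by
        rw [h2, inv_mul_eq_div, le_div_iff₀ (by positivity)]
        nlinarith
      linarith
  have hI := (h.moment_integrable l).const_mul (L ^ (k - 1))⁻¹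
  calc ∫ ω in F, ε l ω ^ 2 ∂μ
      ≤ ∫ ω in F, (L + (L ^ (k - 1))⁻¹ * |ε l ω| ^ (2 * k)) ∂μ :=
        integral_mono (h.sq_integrable l).integrable_sq.integrableOn
          ((integrable_const _).add hI.integrableOn) hpt
    _ = L * μ.real F + ∫ ω in F, (L ^ (k - 1))⁻¹ * |ε l ω| ^ (2 * k) ∂μ := by
        rw [integral_add (integrable_const _) hI.integrableOn]
        simp [mul_comm]
    _ ≤ L * μ.real F + ∫ ω, (L ^ (k - 1))⁻¹ * |ε l ω| ^ (2 * k) ∂μ := by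
        refine add_le_add le_rfl ?_
        exact setIntegral_le_integral hI (Filter.Eventually.of_forall fun ω => by positivity)
    _ ≤ L * (σ ^ 2 / (128 * L)) + (L ^ (k - 1))⁻¹ * M := by
        rw [integral_const_mul]
        gcongr
        exact h.moment_le l
    _ ≤ σ ^ 2 / 128 + σ ^ 2 / 128 := by
        have e1 : L * (σ ^ 2 / (128 * L)) = σ ^ 2 / 128 := by field_simp
        rw [e1, hLk]
        gcongr
        rw [inv_div, div_mul_eq_mul_div, div_le_div_iff₀ (by positivity) (by norm_num)]
        nlinarith [le_abs_self M]
    _ = _ := by ring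

/-- The noise in the column space of the design has second moment at most `σ²` per observation,
and a small share of it on failure events. -/
lemma exists_noise_bound.{u} (k σ M : ℝ) :
    ∃ Q : ℝ, 0 < Q ∧ ∀ {Ω : Type u} [MeasurableSpace Ω] (μ : Measure Ω) [IsProbabilityMeasure μ]
      {r p d : ℕ} (ε : Fin r → Ω → ℝ) (u : Fin d → Fin r → ℝ), 0 < r → ErrorModel μ k σ M ε →
      d ≤ p → (∀ a, sqNorm (u a) = 1) → (∀ w, ∑ a, (u a ⬝ᵥ w) ^ 2 ≤ sqNorm w) →
      (k ≤ 1 → (p : ℝ) ≤ 1 / 64 * r) →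
      Integrable (fun ω => (∑ a, (∑ l, u a l * ε l ω) ^ 2) / r) μ ∧
      ∫ ω, (∑ a, (∑ l, u a l * ε l ω) ^ 2) / r ∂μ ≤ σ ^ 2 ∧
      ∀ F : Set Ω, MeasurableSet F → μ.real F ≤ Q →
        ∫ ω in F, (∑ a, (∑ l, u a l * ε l ω) ^ 2) / r ∂μ ≤ σ ^ 2 / 64 := by
  obtain ⟨Q, hQ, hQ'⟩ : ∃ Q : ℝ, 0 < Q ∧ (σ ≠ 0 → 1 < k → ∀ {Ω : Type u} [MeasurableSpace Ω]
      (μ : Measure Ω) [IsProbabilityMeasure μ]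
      {n : ℕ} (ε : Fin n → Ω → ℝ), ErrorModel μ k σ M ε → ∀ F : Set Ω, MeasurableSet F →
      μ.real F ≤ Q → ∀ l, ∫ ω in F, ε l ω ^ 2 ∂μ ≤ σ ^ 2 / 64) := by
    by_cases h : σ ≠ 0 ∧ 1 < k
    · obtain ⟨Q, hQ, hQ'⟩ := exists_truncation k σ M h.1 h.2
      exact ⟨Q, hQ, fun _ _ => hQ'⟩
    · exact ⟨1, one_pos, fun h1 h2 => absurd ⟨h1, h2⟩ h⟩
  refine ⟨Q, hQ, fun {Ω} _ μ _ {r p d} ε u hr h hd hu1 hu hkp => ?_⟩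
  have hr' : (0 : ℝ) < r := by exact_mod_cast hr
  have hI1 : ∀ a, Integrable (fun ω => (∑ l, u a l * ε l ω) ^ 2) μ := fun a =>
    (h.memLp_sum (u a)).integrable_sq
  have hI : Integrable (fun ω => (∑ a, (∑ l, u a l * ε l ω) ^ 2) / r) μ :=
    (integrable_finsetSum _ fun a _ => hI1 a).div_const _
  have hsq : ∀ l, Integrable (fun ω => ε l ω ^ 2) μ := fun l => (h.sq_integrable l).integrable_sq
  have hIn : Integrable (fun ω => (∑ l, ε l ω ^ 2) / r) μ :=
    (integrable_finsetSum _ fun l _ => hsq l).div_const _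
  have hle : ∀ ω, (∑ a, (∑ l, u a l * ε l ω) ^ 2) / r ≤ (∑ l, ε l ω ^ 2) / r := fun ω => by
    gcongr
    exact hu fun l => ε l ω
  have htot : ∫ ω, (∑ a, (∑ l, u a l * ε l ω) ^ 2) / r ∂μ ≤ σ ^ 2 := by
    refine (integral_mono hI hIn hle).trans (le_of_eq ?_)
    rw [integral_div, integral_finsetSum _ fun l _ => hsq l]
    simp only [h.integral_sq, Finset.sum_const, Finset.card_univ, Fintype.card_fin, nsmul_eq_mul]
    field_simp
  have hnn : ∀ ω, 0 ≤ (∑ a, (∑ l, u a l * ε l ω) ^ 2) / (r : ℝ) := fun ω =>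
    div_nonneg (Finset.sum_nonneg fun _ _ => sq_nonneg _) hr'.le
  refine ⟨hI, htot, fun F hF hFQ => ?_⟩
  have hFle : ∫ ω in F, (∑ a, (∑ l, u a l * ε l ω) ^ 2) / r ∂μ ≤
      ∫ ω, (∑ a, (∑ l, u a l * ε l ω) ^ 2) / r ∂μ :=
    setIntegral_le_integral hI (Filter.Eventually.of_forall hnn)
  by_cases hσ : σ = 0
  · refine hFle.trans (htot.trans ?_)
    simp [hσ]
  -- For `k ≤ 1` the moments give no uniform integrability, but the `d ≤ r / 64` unit directions
  -- carry total mean energy at most `σ² / 64` even without restricting to `F`.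
  rcases le_or_gt k 1 with hk | hk
  · refine hFle.trans ?_
    rw [integral_div, integral_finsetSum _ fun a _ => hI1 a]
    simp only [h.integral_sum_sq, hu1, mul_one, Finset.sum_const, Finset.card_univ,
      Fintype.card_fin, nsmul_eq_mul]
    rw [div_le_iff₀ hr']
    have h1 : (d : ℝ) ≤ 1 / 64 * r := le_trans (by exact_mod_cast hd) (hkp hk)
    nlinarith [sq_nonneg σ]
  · refine (integral_mono hI.integrableOn hIn.integrableOn hle).trans ?_
    rw [integral_div, integral_finsetSum _ fun l _ => (hsq l).integrableOn, div_le_iff₀ hr']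
    refine (Finset.sum_le_sum fun l _ => hQ' hσ hk μ ε h F hF hFQ l).trans (le_of_eq ?_)
    simp
    ring

end Block

/-! ### Choice of the number of blocks -/

section Numerics

/-- Inverts the choice of the number of blocks into a bound of the dimension by the block size. -/
lemma card_le_of_floor {κ A : ℝ} {n p m r : ℕ} (hκ : 0 < κ) (hA : 0 < A) (hp : 0 < p)
    (hm : 0 < m) (hn : n = m * r)
    (h : (m : ℝ) ≤ A ^ κ⁻¹ * n / (p : ℝ) ^ κ⁻¹) : (p : ℝ) ≤ A * (r : ℝ) ^ κ := by
  have hm' : (0 : ℝ) < m := by exact_mod_cast hm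
  have hp' : (0 : ℝ) < p := by exact_mod_cast hp
  rw [le_div_iff₀ (by positivity), hn] at h
  push_cast at h
  have h1 : (p : ℝ) ^ κ⁻¹ ≤ A ^ κ⁻¹ * r := by
    refine le_of_mul_le_mul_left (h.trans (le_of_eq ?_)) hm'
    ring
  have h2 := Real.rpow_le_rpow (by positivity) h1 hκ.le
  rwa [← Real.rpow_mul hp'.le, inv_mul_cancel₀ hκ.ne', Real.rpow_one,
    Real.mul_rpow (by positivity) (by positivity), ← Real.rpow_mul hA.le,
    inv_mul_cancel₀ hκ.ne', Real.rpow_one] at h2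

lemma half_pow_le_failBound {C₀ δ k τ ι α : ℝ} {n p m : ℕ} (hκ : 0 < k * τ - k * ι)
    (hC₀ : 0 < C₀) (hδ : 0 < δ) (hδ' : δ < 1 / 2) (hn : 0 < n) (hp : 0 < p)
    (hpα : (p : ℝ) ≤ (n : ℝ) ^ α)
    (hm : m = ⌊(δ / C₀) ^ (k * τ - k * ι)⁻¹ * (n : ℝ) / (p : ℝ) ^ (k * τ - k * ι)⁻¹⌋₊)
    (hm1 : 1 ≤ m) : (1 / 2 : ℝ) ^ m ≤ failBound C₀ δ k τ ι α n := by
  set κ := k * τ - k * ι with hκdef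
  have hn' : (0 : ℝ) < n := by exact_mod_cast hn
  have hp' : (0 : ℝ) < p := by exact_mod_cast hp
  have hm1' : (1 : ℝ) ≤ m := by exact_mod_cast hm1
  have hx := Nat.lt_floor_add_one ((δ / C₀) ^ κ⁻¹ * (n : ℝ) / (p : ℝ) ^ κ⁻¹)
  rw [← hm] at hx
  set y := (δ / C₀) ^ κ⁻¹ * (n : ℝ) ^ (1 - α * κ⁻¹) with hy
  have hy0 : 0 ≤ y := by positivity
  have hyx : y ≤ (δ / C₀) ^ κ⁻¹ * (n : ℝ) / (p : ℝ) ^ κ⁻¹ := by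
    rw [hy, mul_div_assoc, Real.rpow_sub hn', Real.rpow_one, Real.rpow_mul hn'.le]
    gcongr
  have ha : (1 / 2 - δ) ^ 2 / (2 * (1 - δ)) ≤ 1 / 4 := by
    rw [div_le_iff₀ (by linarith)]
    nlinarith
  have ha0 : 0 ≤ (1 / 2 - δ) ^ 2 / (2 * (1 - δ)) := div_nonneg (sq_nonneg _) (by linarith)
  -- Here `y < m + 1 ≤ 2 m`, and the prefactor is at most `1/4`.
  have hexp : (1 / 2 - δ) ^ 2 / (2 * (1 - δ)) * y ≤ m / 2 := by nlinarith
  have h1 : (1 / 2 : ℝ) ≤ Real.exp (-(1 / 2)) := by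
    have := Real.add_one_le_exp (-(1 / 2) : ℝ)
    linarith
  calc (1 / 2 : ℝ) ^ m ≤ Real.exp (-(1 / 2)) ^ m := by gcongr
    _ = Real.exp (-(m / 2)) := by rw [← Real.exp_nat_mul]; ring_nf
    _ ≤ failBound C₀ δ k τ ι α n := by
        rw [failBound, ← hκdef, mul_assoc _ ((δ / C₀) ^ κ⁻¹), ← hy]
        gcongr

end Numerics

/-! ### Support recovery and risk of the aggregated estimator -/

section Recovery

open Matrix

variable {Ω : Type*} [MeasurableSpace Ω] {μ : Measure Ω} {m : ℕ}

open Classical in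
/-- The outcomes for which at least half of the blocks fail. -/
def majorityFails {E : Type*} (W : Fin m → Ω → E) (A : Fin m → Set E) : Set Ω :=
  {ω | m ≤ 2 * (Finset.univ.filter fun j => W j ω ∈ A j).card}

section

variable {E : Type*} [MeasurableSpace E] {W : Fin m → Ω → E} {A : Fin m → Set E}

lemma measurableSet_majorityFails (hWm : ∀ j, Measurable (W j)) (hA : ∀ j, MeasurableSet (A j)) :
    MeasurableSet (majorityFails W A) :=
  measurableSet_majority hWm hA

lemma setIntegral_majorityFails_le (hW : iIndepFun W μ) (hWm : ∀ j, Measurable (W j))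
    (hA : ∀ j, MeasurableSet (A j)) (hP : ∀ j, μ.real (W j ⁻¹' A j) ≤ 1 / 64) {Z : E → ℝ}
    (hZ : Measurable Z) (hZ0 : ∀ x, 0 ≤ Z x) (i : Fin m)
    (hI : Integrable (fun ω => Z (W i ω)) μ) {v : ℝ} (h1 : ∫ ω, Z (W i ω) ∂μ ≤ v)
    (h2 : ∫ ω in W i ⁻¹' A i, Z (W i ω) ∂μ ≤ v / 64) :
    ∫ ω in majorityFails W A, Z (W i ω) ∂μ ≤ (1 / 4) ^ m * v := by
  have := hW.isProbabilityMeasure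
  have hv : 0 ≤ v := (integral_nonneg fun ω => hZ0 _).trans h1
  have hnn : ∀ ν : Measure Ω, 0 ≤ᵐ[ν] fun ω => Z (W i ω) := fun ν =>
    Filter.Eventually.of_forall fun ω => hZ0 _
  have hs2 : ENNReal.ofReal (1 / 8) ^ 2 = ENNReal.ofReal (1 / 64) := by
    rw [← ENNReal.ofReal_pow (by norm_num)]; norm_num
  -- With `s = 1/8`, the failure bound is `s ^ 2 = 1/64` and the rate is `2 s = 1/4`.
  have h := setLIntegral_majority_le hW hWm hA (z := fun x => ENNReal.ofReal (Z x))
    hZ.ennreal_ofReal i (s := ENNReal.ofReal (1 / 8)) (v := ENNReal.ofReal v)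
    (by rw [ENNReal.ofReal_le_one]; norm_num)
    (fun j => by
      rw [hs2, ← ENNReal.ofReal_toReal (measure_ne_top μ (W j ⁻¹' A j))]
      exact ENNReal.ofReal_le_ofReal (hP j))
    (by rw [← ofReal_integral_eq_lintegral_ofReal hI.integrableOn (hnn _), hs2,
          ← ENNReal.ofReal_mul (by norm_num)]
        exact ENNReal.ofReal_le_ofReal (h2.trans (by linarith)))
    (by rw [← ofReal_integral_eq_lintegral_ofReal hI (hnn _)]
        exact ENNReal.ofReal_le_ofReal h1)
  have h28 : 2 * ENNReal.ofReal (1 / 8) = ENNReal.ofReal (1 / 4) := by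
    rw [← ENNReal.ofReal_ofNat, ← ENNReal.ofReal_mul (by norm_num)]; norm_num
  rw [← ofReal_integral_eq_lintegral_ofReal hI.integrableOn (hnn _), h28,
    ← ENNReal.ofReal_pow (by norm_num), ← ENNReal.ofReal_mul (by positivity),
    ENNReal.ofReal_le_ofReal_iff (by positivity)] at h
  exact h

lemma measureReal_majorityFails_le (hm : 0 < m) (hW : iIndepFun W μ)
    (hWm : ∀ j, Measurable (W j)) (hA : ∀ j, MeasurableSet (A j))
    (hP : ∀ j, μ.real (W j ⁻¹' A j) ≤ 1 / 64) : μ.real (majorityFails W A) ≤ (1 / 4) ^ m := by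
  have := hW.isProbabilityMeasure
  have h := setIntegral_majorityFails_le hW hWm hA hP (Z := fun _ => 1) measurable_const
    (fun _ => zero_le_one) ⟨0, hm⟩ (integrable_const _) (v := 1) (by simp)
    (by simpa using hP ⟨0, hm⟩)
  simpa using h

end

variable {n p r : ℕ} {k σ M : ℝ}

lemma measurable_aggregated_loss {ε : Fin n → Ω → ℝ} (hε : ∀ l, Measurable (ε l))
    (e : Fin n ≃ Fin m × Fin r) (X : Matrix (Fin n) (Fin p) ℝ) (β : Fin p → ℝ)
    {γ : Ω → Finset (Fin p)} (hγ : ∀ G, MeasurableSet {ω | γ ω = G}) :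
    Measurable fun ω => sqNorm (aggregated e X (X *ᵥ β + fun l => ε l ω) (γ ω) - β) := by
  classical
  have h1 : (fun ω => sqNorm (aggregated e X (X *ᵥ β + fun l => ε l ω) (γ ω) - β)) =
      fun ω => ∑ G, if γ ω = G then
        sqNorm (aggregated e X (X *ᵥ β + fun l => ε l ω) G - β) else 0 := by
    ext ω; simp
  rw [h1]
  refine Finset.measurable_fun_sum _ fun G _ => Measurable.ite (hγ G) ?_ measurable_const
  simp only [sqNorm, aggregated_eq, Pi.sub_apply]
  refine Finset.measurable_fun_sum _ fun j _ => Measurable.pow_const (Measurable.sub_const ?_ _) _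
  by_cases hj : j ∈ G
  · simp only [extendZero, hj, dif_pos, Pi.add_apply]
    fun_prop
  · simp only [extendZero, hj, dif_neg, not_false_eq_true]
    exact measurable_const

/-- The loss is dominated by the oracle loss `fS` everywhere plus `h` on `B`. Since `fS ≥ 0`, it is
integrated over the whole space and no conditioning on recovery is needed. The factor 2 in `h` is
absorbed by `2 * (1 / 4) ^ m ≤ ρ`. -/
lemma risk_le [IsProbabilityMeasure μ] {ε : Fin n → Ω → ℝ} {V₁ V₂ C ρ : ℝ} {β : Fin p → ℝ}
    {X : Matrix (Fin n) (Fin p) ℝ} {γ : Ω → Finset (Fin p)} (hm : 0 < m) (hr : 0 < r)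
    (hV₁ : 0 < V₁) (hV₂ : 0 < V₂) (hC : 0 < C) (e : Fin n ≃ Fin m × Fin r)
    (hε : ErrorModel μ k σ M ε) (hA1 : ∀ i, CondA1 V₁ V₂ (subX e X i) β)
    (hγ : ∀ G, MeasurableSet {ω | γ ω = G})
    (heig : ∀ᵐ ω ∂μ, ∀ i, MinEigenvalueGE ((1 / (r : ℝ)) • gram (subX e X i) (γ ω)) C)
    {B : Set Ω} (hB : MeasurableSet B) (hγB : ∀ ω ∉ B, γ ω = supp β)
    (hρ : 2 * (1 / 4 : ℝ) ^ m ≤ ρ) (hPB : μ.real B ≤ (1 / 4) ^ m)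
    {d : Fin m → ℕ} (u : ∀ i, Fin (d i) → Fin r → ℝ)
    (hu : ∀ i w, ∑ a, (u i a ⬝ᵥ w) ^ 2 ≤ sqNorm w)
    (huX : ∀ i b w, ((subX e X i *ᵥ b) ⬝ᵥ w) ^ 2 ≤
      sqNorm (subX e X i *ᵥ b) * ∑ a, (u i a ⬝ᵥ w) ^ 2)
    (hI : ∀ i, Integrable (fun ω => (∑ a, (∑ l, u i a l * ε (e.symm (i, l)) ω) ^ 2) / r) μ)
    (hZB : ∀ i, ∫ ω in B, (∑ a, (∑ l, u i a l * ε (e.symm (i, l)) ω) ^ 2) / r ∂μ ≤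
      (1 / 4) ^ m * σ ^ 2) :
    Integrable (fun ω => sqNorm (aggregated e X (X *ᵥ β + fun l => ε l ω) (γ ω) - β)) μ ∧
    ∫ ω, sqNorm (aggregated e X (X *ᵥ β + fun l => ε l ω) (γ ω) - β) ∂μ ≤
      σ ^ 2 * V₂⁻¹ * ((supp β).card : ℝ) / (n : ℝ) +
        ρ * ((1 + 2 * C⁻¹ * ((supp β).card : ℝ) * V₁) * sqNorm β + C⁻¹ * σ ^ 2) := by
  have hm' : (0 : ℝ) < m := by exact_mod_cast hm
  have hr' : (0 : ℝ) < r := by exact_mod_cast hr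
  have hn : (n : ℝ) = m * r := by
    have := Fintype.card_congr e
    simp only [Fintype.card_fin, Fintype.card_prod] at this
    exact_mod_cast this
  set Z : Fin m → Ω → ℝ := fun i ω => (∑ a, (∑ l, u i a l * ε (e.symm (i, l)) ω) ^ 2) / r with hZ
  set c₁ : ℝ := (1 + 2 * C⁻¹ * ((supp β).card : ℝ) * V₁) * sqNorm β with hc₁
  have hc₁0 : 0 ≤ c₁ := mul_nonneg (by positivity) (sqNorm_nonneg _)
  clear_value c₁
  set fS : Ω → ℝ := fun ω => ∑ j, (∑ x, aggWeight e X (supp β) j x * ε x ω) ^ 2 with hfS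
  set h : Ω → ℝ := fun ω => c₁ + 2 * C⁻¹ * ((∑ i, Z i ω) / m) with hh
  have hfSI : Integrable fS μ := integrable_finsetSum _ fun j _ =>
    (hε.memLp_sum (aggWeight e X (supp β) j)).integrable_sq
  have hZI : Integrable (fun ω => 2 * C⁻¹ * ((∑ i, Z i ω) / m)) μ :=
    ((integrable_finsetSum _ fun i _ => hI i).div_const _).const_mul _
  have hhI : Integrable h μ := (integrable_const _).add hZI
  have hgI : Integrable (fun ω => fS ω + B.indicator h ω) μ := hfSI.add (hhI.indicator hB)
  have hfS0 : ∀ ω, 0 ≤ fS ω := fun ω => Finset.sum_nonneg fun _ _ => sq_nonneg _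
  have hle : ∀ᵐ ω ∂μ, sqNorm (aggregated e X (X *ᵥ β + fun l => ε l ω) (γ ω) - β) ≤
      fS ω + B.indicator h ω := by
    filter_upwards [heig] with ω hω
    by_cases hωB : ω ∈ B
    · rw [Set.indicator_of_mem hωB]
      have h1 := sqNorm_aggregated_sub_le hm e X (X *ᵥ β + fun l => ε l ω) (γ ω) β
      have h2 : (∑ i, sqNorm (ols (subX e X i) (subY e (X *ᵥ β + fun l => ε l ω) i) (γ ω) - β)) / m
          ≤ (∑ i, (c₁ + 2 * C⁻¹ * Z i ω)) / m := by
        gcongr with i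
        rw [hc₁]
        exact (hω i).sqNorm_ols_sub_le hr hC (hA1 i).col_le hV₁.le
          (fun l => ε (e.symm (i, l)) ω) (hu i) (huX i)
      have h3 : (∑ i, (c₁ + 2 * C⁻¹ * Z i ω)) / m = h ω := by
        rw [Finset.sum_add_distrib, ← Finset.mul_sum]
        simp only [hh, Finset.sum_const, Finset.card_univ, Fintype.card_fin, nsmul_eq_mul]
        field_simp
      have := hfS0 ω
      linarith
    · rw [Set.indicator_of_notMem hωB, add_zero, hγB ω hωB,
        aggregated_supp_sub hm hr hV₂ e X (fun i => (hA1 i).eig_ge)]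
  refine ⟨hgI.mono' (measurable_aggregated_loss hε.meas e X β hγ).aestronglyMeasurable ?_, ?_⟩
  · filter_upwards [hle] with ω hω
    rwa [Real.norm_of_nonneg (sqNorm_nonneg _)]
  refine (integral_mono_of_nonneg (Filter.Eventually.of_forall fun ω => sqNorm_nonneg _) hgI
    hle).trans ?_
  rw [integral_add hfSI (hhI.indicator hB), integral_indicator hB]
  refine add_le_add ?_ ?_
  · rw [integral_finsetSum _ fun j _ =>
      (hε.memLp_sum (aggWeight e X (supp β) j)).integrable_sq]
    simp_rw [hε.integral_sum_sq]
    calc ∑ j, σ ^ 2 * sqNorm (aggWeight e X (supp β) j)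
        ≤ ∑ j : supp β, σ ^ 2 * (V₂⁻¹ / (m * r)) := by
          gcongr with j
          exact sqNorm_aggWeight_le hm hr hV₂ e X (fun i => (hA1 i).eig_ge) j
      _ = _ := by
          rw [hn]
          simp
          ring
  · have h1 : ∫ ω in B, h ω ∂μ = c₁ * μ.real B + 2 * C⁻¹ * ((∑ i, ∫ ω in B, Z i ω ∂μ) / m) := by
      rw [integral_add (integrable_const _) hZI.integrableOn, integral_const_mul, integral_div,
        integral_finsetSum _ fun i _ => (hI i).integrableOn, setIntegral_const, smul_eq_mul,
        mul_comm c₁]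
    have h2 : (∑ i, ∫ ω in B, Z i ω ∂μ) / m ≤ (1 / 4) ^ m * σ ^ 2 := by
      rw [div_le_iff₀ hm']
      refine (Finset.sum_le_sum fun i _ => hZB i).trans (le_of_eq ?_)
      simp [mul_comm]
    have hρ0 : 0 ≤ (1 / 4 : ℝ) ^ m := by positivity
    have hCσ : 0 ≤ C⁻¹ * σ ^ 2 := by positivity
    rw [h1]
    calc c₁ * μ.real B + 2 * C⁻¹ * ((∑ i, ∫ ω in B, Z i ω ∂μ) / m)
        ≤ c₁ * (1 / 4) ^ m + 2 * C⁻¹ * ((1 / 4) ^ m * σ ^ 2) := by gcongr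
      _ = c₁ * (1 / 4) ^ m + 2 * (1 / 4) ^ m * (C⁻¹ * σ ^ 2) := by ring
      _ ≤ c₁ * ρ + ρ * (C⁻¹ * σ ^ 2) := by
          gcongr
          linarith
      _ = _ := by ring

end Recovery

/-! ### Rates -/

section Rates

variable {ι τ V₁ V₂ c₀ c₁ c₂ η : ℝ} {r p : ℕ}

lemma signal_gap_pos (hc₁ : 0 < c₁) (hV₂ : 0 < V₂)
    (hc₀' : c₀ < 2 * c₂ * V₂ / Real.sqrt c₁) : 0 < c₂ - c₀ * Real.sqrt c₁ / (2 * V₂) := by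
  rw [lt_div_iff₀ (Real.sqrt_pos.2 hc₁)] at hc₀'
  rw [sub_pos, div_lt_iff₀ (by positivity)]
  linarith

/-- The exponent of the penalty makes the shrinkage `lam * √s` of the same order as the minimal
signal; the gap between the constants is the room left for noise. -/
lemma threshold_add_le_signal (hr : 0 < r) (hV₂ : 0 < V₂) (hc₁ : 0 < c₁) (hc₀ : 0 < c₀)
    {β : Fin p → ℝ} (h : CondA2 c₁ c₂ ι τ r β) {j : Fin p} (hj : j ∈ supp β) :
    (c₂ - c₀ * Real.sqrt c₁ / (2 * V₂)) * (r : ℝ) ^ (-((1 - τ) / 2)) +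
      c₀ * (r : ℝ) ^ (-((ι - τ + 1) / 2)) * Real.sqrt (supp β).card / (2 * V₂) ≤ |β j| := by
  have hr' : (0 : ℝ) < r := by exact_mod_cast hr
  refine le_trans ?_ (h.signal j hj)
  have h1 : Real.sqrt (supp β).card ≤ Real.sqrt c₁ * (r : ℝ) ^ (ι / 2) := by
    refine (Real.sqrt_le_sqrt h.sparse).trans (le_of_eq ?_)
    rw [Real.sqrt_mul hc₁.le, Real.sqrt_eq_rpow ((r : ℝ) ^ ι), ← Real.rpow_mul hr'.le]
    ring_nf
  have h2 : (r : ℝ) ^ (-((ι - τ + 1) / 2)) * (r : ℝ) ^ (ι / 2) = (r : ℝ) ^ (-((1 - τ) / 2)) := by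
    rw [← Real.rpow_add hr']; ring_nf
  have h3 : c₀ * (r : ℝ) ^ (-((ι - τ + 1) / 2)) * Real.sqrt (supp β).card / (2 * V₂) ≤
      c₀ * Real.sqrt c₁ / (2 * V₂) * (r : ℝ) ^ (-((1 - τ) / 2)) := by
    calc c₀ * (r : ℝ) ^ (-((ι - τ + 1) / 2)) * Real.sqrt (supp β).card / (2 * V₂)
        ≤ c₀ * (r : ℝ) ^ (-((ι - τ + 1) / 2)) * (Real.sqrt c₁ * (r : ℝ) ^ (ι / 2)) / (2 * V₂) := by
          gcongr
      _ = _ := by rw [← h2]; ring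
  linarith

/-- On the support the natural rate is `r ^ (-τ)`; a factor `r ^ ι ≥ 1` is given away to match the
off-support rate `r ^ (-(τ - ι))`. -/
lemma inv_le_rate_mul_sq {g D : ℝ} (hr : 0 < r) (hι : 0 ≤ ι) (hV₂ : 0 < V₂) (hg : 0 < g)
    (hD : 1 / (V₂ * g ^ 2) ≤ D) :
    1 / (r * V₂) ≤ D * (r : ℝ) ^ (-(τ - ι)) * (g * (r : ℝ) ^ (-((1 - τ) / 2))) ^ 2 := by
  have hr' : (0 : ℝ) < r := by exact_mod_cast hr
  have h1 : ((r : ℝ) ^ (-((1 - τ) / 2))) ^ 2 = (r : ℝ) ^ (-(1 - τ)) := by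
    rw [← Real.rpow_natCast, ← Real.rpow_mul hr'.le]; push_cast; ring_nf
  have h2 : (r : ℝ) ^ (-(τ - ι)) * (r : ℝ) ^ (-(1 - τ)) = (r : ℝ)⁻¹ * (r : ℝ) ^ ι := by
    rw [← Real.rpow_add hr', ← Real.rpow_neg_one, ← Real.rpow_add hr']; ring_nf
  have h3 : (1 : ℝ) ≤ (r : ℝ) ^ ι := Real.one_le_rpow (by exact_mod_cast hr) hι
  calc 1 / (r * V₂) = 1 / (V₂ * g ^ 2) * g ^ 2 * ((r : ℝ)⁻¹ * 1) := by field_simp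
    _ ≤ D * g ^ 2 * ((r : ℝ)⁻¹ * (r : ℝ) ^ ι) := by
        have : 0 ≤ D := le_trans (by positivity) hD
        gcongr
    _ = _ := by rw [mul_pow, h1, ← h2]; ring

lemma le_rate_mul_sq {D : ℝ} (hr : 0 < r) (hη : 0 < η) (hc₀ : 0 < c₀)
    (hD : 4 * V₁ / (η ^ 2 * c₀ ^ 2) ≤ D) :
    r * V₁ ≤ D * (r : ℝ) ^ (-(τ - ι)) *
      (η * (c₀ * (r : ℝ) ^ (-((ι - τ + 1) / 2))) * r / 2) ^ 2 := by
  have hr' : (0 : ℝ) < r := by exact_mod_cast hr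
  have h1 : ((r : ℝ) ^ (-((ι - τ + 1) / 2))) ^ 2 = (r : ℝ) ^ (-(ι - τ + 1)) := by
    rw [← Real.rpow_natCast, ← Real.rpow_mul hr'.le]; push_cast; ring_nf
  have h2 : (r : ℝ) ^ (-(τ - ι)) * (r : ℝ) ^ (-(ι - τ + 1)) = (r : ℝ)⁻¹ := by
    rw [← Real.rpow_add hr', ← Real.rpow_neg_one]; ring_nf
  calc r * V₁ = 4 * V₁ / (η ^ 2 * c₀ ^ 2) * (η ^ 2 * c₀ ^ 2 * (r : ℝ) ^ 2 / 4 * (r : ℝ)⁻¹) := by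
        field_simp
    _ ≤ D * (η ^ 2 * c₀ ^ 2 * (r : ℝ) ^ 2 / 4 * (r : ℝ)⁻¹) := by gcongr
    _ = _ := by
        rw [← h2, div_pow, mul_pow, mul_pow, mul_pow, h1]
        ring

lemma measureReal_block_failSet_le {Ω : Type*} [MeasurableSpace Ω] {μ : Measure Ω}
    [IsProbabilityMeasure μ] {ε : Fin r → Ω → ℝ} {k K D g : ℝ} {X : Matrix (Fin r) (Fin p) ℝ}
    {β : Fin p → ℝ} (hk : 0 < k) (hι : 0 ≤ ι) (hr : 0 < r) (hV₂ : 0 < V₂) (hη : 0 < η)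
    (hc₀ : 0 < c₀) (hg : 0 < g) (hK : 0 < K) (hD₁ : 1 / (V₂ * g ^ 2) ≤ D)
    (hD₂ : 4 * V₁ / (η ^ 2 * c₀ ^ 2) ≤ D)
    (htail : ∀ (a : Fin r → ℝ) (t : ℝ), 0 < t →
      μ.real {ω | t ≤ |∑ l, a l * ε l ω|} ≤ K * (sqNorm a / t ^ 2) ^ k)
    (hA1 : CondA1 V₁ V₂ X β) :
    μ.real ((fun ω l => ε l ω) ⁻¹' failSet X (supp β) (g * (r : ℝ) ^ (-((1 - τ) / 2)))
      (η * (c₀ * (r : ℝ) ^ (-((ι - τ + 1) / 2))) * r / 2)) ≤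
      p * (K * (D * (r : ℝ) ^ (-(τ - ι))) ^ k) := by
  have hr' : (0 : ℝ) < r := by exact_mod_cast hr
  have hcol : ∀ j, ∑ l, X l j ^ 2 ≤ r * V₁ := fun j => by
    have := hA1.col_le j
    rw [one_div, inv_mul_eq_div, div_le_iff₀ hr'] at this
    linarith
  refine measureReal_failSet_le hk hK htail X (supp β) (by positivity) (by positivity)
    (fun j => ?_) (fun j _ => ?_)
  · exact (hA1.eig_ge.sqNorm_lsWeight_le hr hV₂ j).trans
      (inv_le_rate_mul_sq hr hι hV₂ hg hD₁)
  · exact ((hA1.eig_ge.sqNorm_residCol_le hr hV₂ j).trans (hcol j)).trans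
      (le_rate_mul_sq hr hη hc₀ hD₂)

lemma mul_rate_le {k K D C₀ δ : ℝ} (hr : 0 < r) (hK : 0 ≤ K) (hD : 0 < D) (hC₀ : 0 < C₀)
    (hδ : δ < 1 / 2) (hpr : (p : ℝ) ≤ δ / C₀ * (r : ℝ) ^ (k * τ - k * ι)) :
    p * (K * (D * (r : ℝ) ^ (-(τ - ι))) ^ k) ≤ K * D ^ k / C₀ := by
  have hr' : (0 : ℝ) < r := by exact_mod_cast hr
  have h1 : (D * (r : ℝ) ^ (-(τ - ι))) ^ k = D ^ k * ((r : ℝ) ^ (k * τ - k * ι))⁻¹ := by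
    rw [Real.mul_rpow hD.le (by positivity), ← Real.rpow_mul hr'.le, ← Real.rpow_neg hr'.le]
    ring_nf
  rw [h1]
  calc (p : ℝ) * (K * (D ^ k * ((r : ℝ) ^ (k * τ - k * ι))⁻¹))
      ≤ (δ / C₀ * (r : ℝ) ^ (k * τ - k * ι)) *
          (K * (D ^ k * ((r : ℝ) ^ (k * τ - k * ι))⁻¹)) := by gcongr
    _ = δ * (K * D ^ k / C₀) := by field_simp
    _ ≤ 1 * (K * D ^ k / C₀) := by
        have : 0 ≤ K * D ^ k / C₀ := by positivity
        gcongr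
        linarith
    _ = _ := one_mul _

lemma le_mul_of_rate {k A c : ℝ} (hr : 0 < r) (hk1 : k ≤ 1) (hι : 0 ≤ ι)
    (hιτ : ι ≤ τ) (hτ : τ ≤ 1) (hA : A ≤ c) (hpr : (p : ℝ) ≤ A * (r : ℝ) ^ (k * τ - k * ι)) :
    (p : ℝ) ≤ c * r := by
  have hr' : (0 : ℝ) < r := by exact_mod_cast hr
  have hpow : 0 < (r : ℝ) ^ (k * τ - k * ι) := by positivity
  have hA0 : 0 ≤ A := nonneg_of_mul_nonneg_left ((Nat.cast_nonneg p).trans hpr) hpow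
  have h1 : (r : ℝ) ^ (k * τ - k * ι) ≤ (r : ℝ) ^ (1 : ℝ) := by
    refine Real.rpow_le_rpow_of_exponent_le (by exact_mod_cast hr) ?_
    rw [← mul_sub]
    exact mul_le_one₀ hk1 (by linarith) (by linarith)
  rw [Real.rpow_one] at h1
  exact hpr.trans (mul_le_mul hA h1 hpow.le (hA0.trans hA))

end Rates

end Message

/-! ### Choice of the uniform constant and assembly -/

theorem theorem2 (k τ ι V₁ V₂ c₀ c₁ c₂ η σ M : ℝ)
    (hk : 0 < k) (hι : 0 ≤ ι) (hιτ : ι < τ) (hτ : τ ≤ 1)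
    (hV₁ : 0 < V₁) (hV₂ : 0 < V₂) (hc₁ : 0 < c₁) (hc₂ : 0 < c₂) (hη : 0 < η)
    (hc₀ : 0 < c₀) (hc₀' : c₀ < 2 * c₂ * V₂ / Real.sqrt c₁) :
    ∃ C₀ : ℝ, 0 < C₀ ∧
      ∀ (n p m r : ℕ) (α δ : ℝ) (e : Fin n ≃ Fin m × Fin r)
        (X : Matrix (Fin n) (Fin p) ℝ) (β : Fin p → ℝ)
        {Ω : Type*} [MeasurableSpace Ω] (μ : Measure Ω) [IsProbabilityMeasure μ]
        (ε : Fin n → Ω → ℝ) (Y : Ω → Fin n → ℝ)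
        (b : Fin m → Ω → Fin p → ℝ) (γ : Ω → Finset (Fin p)),
        α < k * (τ - ι) → (p : ℝ) ≤ (n : ℝ) ^ α →
        0 < δ → δ < 1 / 2 →
        (2 * C₀ * (p : ℝ)) ^ (k * τ - k * ι)⁻¹ ≤ (n : ℝ) →
        m = ⌊(δ / C₀) ^ (k * τ - k * ι)⁻¹ * (n : ℝ) / (p : ℝ) ^ (k * τ - k * ι)⁻¹⌋₊ →
        1 ≤ m →
        Message.ErrorModel μ k σ M ε →
        (∀ ω, Y ω = X.mulVec β + fun l => ε l ω) →
        (∀ i, Message.CondA1 V₁ V₂ (Message.subX e X i) β) →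
        Message.CondA2 c₁ c₂ ι τ r β →
        (∀ i, Message.CondA3 η (Message.subX e X i) β) →
        (∀ i ω, Message.IsLasso (c₀ * ((n : ℝ) / (m : ℝ)) ^ (-((ι - τ + 1) / 2)))
          (Message.subX e X i) (Message.subY e (Y ω) i) (b i ω)) →
        (∀ ω, Message.IsMedianModel (fun i => Message.supp (b i ω)) (γ ω)) →
        (∀ G, MeasurableSet {ω | γ ω = G}) →
        1 - Message.failBound C₀ δ k τ ι α n ≤ μ.real {ω | γ ω = Message.supp β} ∧
        ∀ C' : ℝ, 0 < C' →
          (∀ᵐ ω ∂μ, ∀ i, Message.MinEigenvalueGE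
            ((1 / (r : ℝ)) • Message.gram (Message.subX e X i) (γ ω)) C') →
          Integrable
            (fun ω => Message.sqNorm (Message.aggregated e X (Y ω) (γ ω) - β)) μ ∧
          ∫ ω, Message.sqNorm (Message.aggregated e X (Y ω) (γ ω) - β) ∂μ ≤
            σ ^ 2 * V₂⁻¹ * ((Message.supp β).card : ℝ) / (n : ℝ) +
              Message.failBound C₀ δ k τ ι α n *
                ((1 + 2 * C'⁻¹ * ((Message.supp β).card : ℝ) * V₁) * Message.sqNorm β +
                  C'⁻¹ * σ ^ 2) := by
  obtain ⟨K, hK, htail⟩ := Message.exists_tail_bound k σ M hk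
  obtain ⟨Q, hQ, hnoise⟩ := Message.exists_noise_bound k σ M
  have hg := Message.signal_gap_pos hc₁ hV₂ hc₀'
  set g := c₂ - c₀ * Real.sqrt c₁ / (2 * V₂) with hgdef
  set D := 1 / (V₂ * g ^ 2) + 4 * V₁ / (η ^ 2 * c₀ ^ 2) with hD
  have hD1 : 0 < 1 / (V₂ * g ^ 2) := by positivity
  have hD2 : 0 < 4 * V₁ / (η ^ 2 * c₀ ^ 2) := by positivity
  have hD0 : 0 < D := by positivity
  -- The summands with `Q⁻¹` and `64` bring the block failure probability below `Q` and `1/64`; the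
  -- final `64` gives `δ / C₀ ≤ 1/64`, hence `p ≤ r / 64` when `k ≤ 1`.
  set C₀ := K * D ^ k * (Q⁻¹ + 64) + 64 with hC₀
  have hKD : 0 < K * D ^ k := by positivity
  have hC₀pos : 0 < C₀ := by positivity
  refine ⟨C₀, hC₀pos, ?_⟩
  intro n p m r α δ e X β Ω _ μ _ ε Y b γ _ hpα hδ hδ' _ hm hm1 hε hY hA1 hA2 hA3 hb hγ hγm
  have hκ : 0 < k * τ - k * ι := by
    rw [← mul_sub]
    exact mul_pos hk (sub_pos.2 hιτ)
  have hn : n = m * r := by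
    have := Fintype.card_congr e
    simpa only [Fintype.card_fin, Fintype.card_prod] using this
  have hx1 : (m : ℝ) ≤ (δ / C₀) ^ (k * τ - k * ι)⁻¹ * (n : ℝ) / (p : ℝ) ^ (k * τ - k * ι)⁻¹ := by
    conv_lhs => rw [hm]
    exact Nat.floor_le (by positivity)
  have hm' : (1 : ℝ) ≤ m := by exact_mod_cast hm1
  -- For `p = 0` the quotient defining `m` is a division by zero, which has value 0 and contradicts
  -- `m ≥ 1`.
  have hp : 0 < p := by
    rcases Nat.eq_zero_or_pos p with rfl | h
    · rw [Nat.cast_zero, Real.zero_rpow (inv_ne_zero hκ.ne'), div_zero] at hx1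
      linarith
    · exact h
  have hn0 : 0 < n := by
    rcases Nat.eq_zero_or_pos n with h | h
    · rw [h, Nat.cast_zero, mul_zero, zero_div] at hx1
      linarith
    · exact h
  have hr : 0 < r := Nat.pos_of_ne_zero fun h => by simp [hn, h] at hn0
  have hr' : (0 : ℝ) < r := by exact_mod_cast hr
  have hnm : (n : ℝ) / m = r := by
    rw [hn, Nat.cast_mul, mul_comm, mul_div_assoc, div_self (by linarith), mul_one]
  have hpr := Message.card_le_of_floor hκ (div_pos hδ hC₀pos) hp hm1 hn hx1
  have hρ := Message.half_pow_le_failBound hκ hC₀pos hδ hδ' hn0 hp hpα hm hm1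
  set ρ := Message.failBound C₀ δ k τ ι α n with hρdef
  -- Since `m ≥ 1`, `2 (1/4)^m ≤ (1/2)^m`.
  have hρ2 : 2 * (1 / 4 : ℝ) ^ m ≤ ρ := by
    refine le_trans ?_ hρ
    have h1 : (1 / 4 : ℝ) ^ m = (1 / 2) ^ m * (1 / 2) ^ m := by rw [← mul_pow]; norm_num
    have h2 : (1 / 2 : ℝ) ^ m ≤ (1 / 2) ^ 1 :=
      pow_le_pow_of_le_one (by norm_num) (by norm_num) hm1
    have h3 : (0 : ℝ) < (1 / 2) ^ m := by positivity
    rw [h1]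
    nlinarith
  set S := Message.supp β with hS
  set lam := c₀ * (r : ℝ) ^ (-((ι - τ + 1) / 2)) with hlam
  have hlam0 : 0 < lam := by positivity
  set t₁ := g * (r : ℝ) ^ (-((1 - τ) / 2)) with ht₁
  have ht₁0 : 0 < t₁ := by positivity
  set W : Fin m → Ω → Fin r → ℝ := fun i ω l => ε (e.symm (i, l)) ω with hW
  set A : Fin m → Set (Fin r → ℝ) := fun i =>
    Message.failSet (Message.subX e X i) S t₁ (η * lam * r / 2) with hA
  have hWm : ∀ i, Measurable (W i) := fun i => measurable_pi_lambda _ fun l => hε.meas _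
  have hAm : ∀ i, MeasurableSet (A i) := fun i => Message.measurableSet_failSet _ _ _ _
  have hWind : iIndepFun W μ := Message.iIndepFun_blocks hε.indep hε.meas e
  have hεi : ∀ i, Message.ErrorModel μ k σ M (fun l : Fin r => ε (e.symm (i, l))) := fun i =>
    hε.precomp (g := fun l => e.symm (i, l)) fun a b hab => by simpa using hab
  have hPle : ∀ i, μ.real (W i ⁻¹' A i) ≤ K * D ^ k / C₀ := fun i =>
    (Message.measureReal_block_failSet_le hk hι hr hV₂ hη hc₀ hg hK (by linarith) (by linarith)
      (htail μ _ (hεi i)) (hA1 i)).trans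
      (Message.mul_rate_le hr hK.le hD0 hC₀pos hδ' hpr)
  have hPQ : ∀ i, μ.real (W i ⁻¹' A i) ≤ Q := fun i => (hPle i).trans (by
    rw [div_le_iff₀ hC₀pos, hC₀]
    have : Q * (K * D ^ k * (Q⁻¹ + 64) + 64) = K * D ^ k + Q * (K * D ^ k * 64 + 64) := by
      field_simp
      ring
    rw [this]
    have : 0 < Q * (K * D ^ k * 64 + 64) := by positivity
    linarith)
  have hP64 : ∀ i, μ.real (W i ⁻¹' A i) ≤ 1 / 64 := fun i => (hPle i).trans (by
    rw [div_le_iff₀ hC₀pos, hC₀]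
    have : 0 < K * D ^ k * Q⁻¹ := by positivity
    linarith)
  set B := Message.majorityFails W A with hB
  have hBm : MeasurableSet B := Message.measurableSet_majorityFails hWm hAm
  have hPB : μ.real B ≤ (1 / 4) ^ m := Message.measureReal_majorityFails_le hm1 hWind hWm hAm hP64
  have hγB : ∀ ω ∉ B, γ ω = S := by
    classical
    intro ω hω
    refine (hγ ω).eq_of_majority (B := Finset.univ.filter fun j => W j ω ∈ A j) (fun i hi => ?_) ?_
    · have hi' : W i ω ∉ A i := by simpa using hi
      have hbi := hb i ω
      rw [hnm, hY ω] at hbi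
      exact hbi.supp_eq_of_notMem_failSet hr hV₂ hlam0 (hA1 i).eig_ge (hA3 i)
        (fun j hj => Message.threshold_add_le_signal hr hV₂ hc₁ hc₀ hA2 hj) hi'
    · simp only [hB, Message.majorityFails, Set.mem_ofPred_eq, not_le] at hω
      convert hω
  refine ⟨?_, fun C' hC' heig => ?_⟩
  · have h1 : μ.real Bᶜ ≤ μ.real {ω | γ ω = S} := measureReal_mono fun ω hω => hγB ω hω
    rw [measureReal_compl hBm, probReal_univ] at h1
    have : (0 : ℝ) ≤ (1 / 4) ^ m := by positivity
    linarith
  · simp only [hY]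
    choose d hdp u hu1 hu huX using fun i => Message.exists_orthonormal_frame (Message.subX e X i)
    have hkp : k ≤ 1 → (p : ℝ) ≤ 1 / 64 * r := by
      intro hk1
      have h1 : δ / C₀ ≤ 1 / 64 := by
        rw [div_le_iff₀ hC₀pos, hC₀]
        have : 0 < K * D ^ k * (Q⁻¹ + 64) := by positivity
        linarith
      exact Message.le_mul_of_rate hr hk1 hι hιτ.le hτ h1 hpr
    have hN := fun i => hnoise μ (fun l : Fin r => ε (e.symm (i, l))) (u i) hr (hεi i) (hdp i)
      (hu1 i) (hu i) hkp
    refine Message.risk_le hm1 hr hV₁ hV₂ hC' e hε hA1 hγm heig hBm hγB hρ2 hPB u hu huX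
      (fun i => (hN i).1) fun i => ?_
    exact Message.setIntegral_majorityFails_le hWind hWm hAm hP64
      (Z := fun w => (∑ a, (∑ l, u i a l * w l) ^ 2) / r) (by fun_prop)
      (fun w => div_nonneg (Finset.sum_nonneg fun _ _ => sq_nonneg _) hr'.le) i (hN i).1
      (hN i).2.1 ((hN i).2.2 _ (hWm i (hAm i)) (hPQ i))
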